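/- Let $\alpha>0$ and $m\in\mathbb{R}$, and consider on $(0,\infty)$ the equation $$x^m f(x)=\frac{1}{\Gamma(\alpha)}\int_0^x (x-v)^{\alpha-1}f(v)\,dv ,\qquad (\ast)$$ that is, $\mathrm{I}^{\alpha}_{0+}f=x^m f$ with $\mathrm{I}^{\alpha}_{0+}$ the left-sided Riemann–Liouville fractional integral. A density solution is a probability density $f$ on $(0,\infty)$ (with respect to Lebesgue measure) satisfying $(\ast)$, the integral being absolutely convergent. Theorem. (i) A density solution satisfying $(\ast)$ for every $x>0$ exists if and only if $m>\alpha$; likewise, a density solution satisfying $(\ast)$ for almost every $x>0$ exists if and only if $m>\alpha$. (ii) The solution is unique: any two density solutions satisfying $(\ast)$ for every $x>0$ coincide on $(0,\infty)$, and any two satisfying $(\ast)$ for almost every $x>0$ coincide almost everywhere on $(0,\infty)$. (iii) Let $m>\alpha$ and $a=m-\alpha$. The density solution is the density of a positive random variable $X_{m,\alpha}$ with $$X_{m,\alpha}\;\stackrel{d}{=}\;\left(a^{\frac{m-a}{a}}\,\Gamma\!\left(\tfrac{m}{a}\right)\prod_{n=0}^{\infty}\left(\frac{m+an}{a+an}\right)\mathbf{B}_{a+an,\,m-a}\right)^{-1}\;\stackrel{d}{=}\;\left(\frac{\Gamma(m)}{\Gamma(a)}\prod_{n=0}^{\infty}\left(\frac{m+n}{a+n}\right)\mathbf{B}_{1+\frac{n}{a},\,\frac{m}{a}-1}\right)^{-\frac{1}{a}}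 .$$ Here $\mathbf{B}_{p,q}$ denotes a Beta random variable, with density $\frac{\Gamma(p+q)}{\Gamma(p)\Gamma(q)}x^{p-1}(1-x)^{q-1}$ on $(0,1)$; in each of the two products the Beta variables are independent, and the partial products $\prod_{n=0}^{N-1}$ converge almost surely, as $N\to\infty$, to a positive finite limit. -/

import Mathlib

open MeasureTheory ProbabilityTheory Filter Topology Set

universe u

noncomputable section

/-- The left-sided Riemann-Liouville fractional integral of order `α` on the half-axis,
`(I^α_{0+} f)(x) = Γ(α)⁻¹ ∫_0^x (x - v)^(α - 1) f(v) dv`. -/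
def riemannLiouville (α : ℝ) (f : ℝ → ℝ) (x : ℝ) : ℝ :=
  (1 / Real.Gamma α) * ∫ v in Ioo 0 x, (x - v) ^ (α - 1) * f v

/-- `f` solves `I^α_{0+} f = x^m f` at the point `x`: the integral defining the left-hand side
converges absolutely and the two sides agree. -/
def SolvesAt (α m : ℝ) (f : ℝ → ℝ) (x : ℝ) : Prop :=
  IntegrableOn (fun v => (x - v) ^ (α - 1) * f v) (Ioo 0 x) ∧
    x ^ m * f x = riemannLiouville α f x

/-- `f` is a probability density on `(0, ∞)` with respect to Lebesgue measure (the values of `f`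
outside `(0, ∞)` are irrelevant). -/
structure IsPositiveDensity (f : ℝ → ℝ) : Prop where
  aemeasurable : AEMeasurable f (volume.restrict (Ioi 0))
  nonneg : ∀ᵐ x ∂(volume.restrict (Ioi (0 : ℝ))), 0 ≤ f x
  lintegral_eq_one : ∫⁻ x in Ioi (0 : ℝ), ENNReal.ofReal (f x) = 1

/-- The law on `(0, ∞)` with density `f`, as a measure on `ℝ`. -/
def densityLaw (f : ℝ → ℝ) : Measure ℝ :=
  (volume.restrict (Ioi 0)).withDensity fun x => ENNReal.ofReal (f x)

/-- A density solution: a probability density on `(0, ∞)` that satisfies the equation at every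
`x > 0`. -/
structure IsDensitySolution (α m : ℝ) (f : ℝ → ℝ) : Prop where
  density : IsPositiveDensity f
  solves : ∀ x, 0 < x → SolvesAt α m f x

/-- A density solution in the almost everywhere sense: a probability density on `(0, ∞)` that
satisfies the equation at almost every `x > 0`. -/
structure IsAEDensitySolution (α m : ℝ) (f : ℝ → ℝ) : Prop where
  density : IsPositiveDensity f
  solves : ∀ᵐ x ∂(volume.restrict (Ioi (0 : ℝ))), SolvesAt α m f x

/-- `B 0, B 1, …` are independent random variables and `B n` has the Beta law with parameters
`p n` and `q n`. -/
structure IsIndepBetaSeq {Ω : Type*} [MeasurableSpace Ω] (p q : ℕ → ℝ) (B : ℕ → Ω → ℝ)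
    (P : Measure Ω) : Prop where
  hasLaw : ∀ n, HasLaw (B n) (betaMeasure (p n) (q n)) P
  indep : iIndepFun B P

/-- The infinite product `∏_{n ≥ 0} Y n` converges almost surely (in the usual sense: the partial
products have a nonzero limit, here positive), with value `Z`. -/
def IsASInfiniteProduct {Ω : Type*} [MeasurableSpace Ω] (Y : ℕ → Ω → ℝ) (Z : Ω → ℝ)
    (P : Measure Ω) : Prop :=
  ∀ᵐ ω ∂P, 0 < Z ω ∧ Tendsto (fun N => ∏ n ∈ Finset.range N, Y n ω) atTop (𝓝 (Z ω))

end

/-!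
The argument runs through the moments `E X^s` of the law with density `f`.

*The recursion.* The Laplace transform turns `I^α` into multiplication by `l ^ (-α)`
(`laplace_fracIntegral`), so that `E (X^m e^(-l X)) = l^(-α) E e^(-l X)` for a density solution.
Letting `l → 0` gives `α < m` (`lt_of_laplace_eq`). Integrating the same identity against powers of
`l` gives, with `a = m - α`, the recursion `E X^(a - t) = Γ(t) / Γ(t + α) * E X^(-t)` for all real
`t > 0` (`MomentRecursion`).

*Uniqueness.* Moments of integer order need not determine the law (they grow like `n!^α`), but the
recursion holds in a real variable, and moments are log-convex in the order. As
`Γ(t + α) / Γ(t) ~ t^α` varies slowly, the recursion has only one log-convex solution, as in the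
theorem of Bohr and Mollerup (`eq_of_logConvex_recursion`). Moments of order near `0` are finite
and determine the law, by analytic continuation to the imaginary axis (`ext_of_rpowMoment_eq`).

*Products.* In both products the factors have mean one, so the partial products form a positive
martingale, which converges almost surely. The moments of the partial products are products of Gamma
quotients; shifting the order by `1`, or by the step `d` of the first Beta parameter, makes them
telescope. This bounds the moments of each order `s > -p` uniformly
(`exists_betaProd_le_of_moments`), whence the limit is positive and its moments are the limits of
the moments. The limits satisfy the moment recursion after the normalization in the theorem
(`IsIndepBetaSeq.exists_momentRecursion_inv`, `IsIndepBetaSeq.exists_momentRecursion_rpow`), so by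
uniqueness the laws agree.

*Existence.* For `α < m` the product provides a law `μ` that satisfies the recursion. The recursion
says that `x^m μ(dx)` and `I^α μ(x) dx` have the same moments, hence `μ` has the density
`x^(-m) I^α μ(x)` (`MomentRecursion.eq_withDensity`). For this version the equation holds at every
point, once `I^α μ` is known to be finite everywhere; this follows by iterating the equation until
the kernel is bounded (`MomentRecursion.fracIntegral_ne_top`).
-/

/-! ### Ratios of Gamma values -/

/-- Upper half of Wendel's inequality, from the log-convexity of `Γ`. -/
lemma Gamma_add_le_mul_rpow {x s : ℝ} (hx : 0 < x) (h0 : 0 ≤ s) (h1 : s ≤ 1) :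
    Real.Gamma (x + s) ≤ Real.Gamma x * x ^ s := by
  have hG := Real.Gamma_pos_of_pos hx
  rcases h0.eq_or_lt with rfl | h0
  · simp
  rcases h1.eq_or_lt with rfl | h1
  · rw [Real.Gamma_add_one hx.ne', Real.rpow_one, mul_comm]
  have h := Real.Gamma_mul_add_mul_le_rpow_Gamma_mul_rpow_Gamma hx (show 0 < x + 1 by linarith)
    (show 0 < 1 - s by linarith) h0 (by ring)
  rw [Real.Gamma_add_one hx.ne', Real.mul_rpow hx.le hG.le] at h
  calc Real.Gamma (x + s) = Real.Gamma ((1 - s) * x + s * (x + 1)) := by ring_nf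
    _ ≤ _ := h
    _ = Real.Gamma x ^ ((1 - s) + s) * x ^ s := by rw [Real.rpow_add hG]; ring
    _ = _ := by simp

lemma tendsto_add_div_rpow (b p : ℝ) :
    Tendsto (fun x : ℝ => ((x + b) / x) ^ p) atTop (𝓝 1) := by
  have h : Tendsto (fun x : ℝ => 1 + b / x) atTop (𝓝 (1 + 0)) :=
    tendsto_const_nhds.add (tendsto_const_nhds.div_atTop tendsto_id)
  have h2 : Tendsto (fun x : ℝ => (1 + b / x) ^ p) atTop (𝓝 (1 ^ p)) := by
    simpa using h.rpow_const (p := p) (Or.inl (by norm_num))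
  rw [Real.one_rpow] at h2
  refine h2.congr' ?_
  filter_upwards [eventually_gt_atTop 0] with x hx
  congr 1
  field_simp

lemma tendsto_Gamma_add_div_of_le_one {s : ℝ} (h0 : 0 ≤ s) (h1 : s ≤ 1) :
    Tendsto (fun x : ℝ => Real.Gamma (x + s) / (Real.Gamma x * x ^ s)) atTop (𝓝 1) := by
  have hl : Tendsto (fun x : ℝ => ((x + s) / x) ^ (-(1 - s))) atTop (𝓝 1) :=
    tendsto_add_div_rpow _ _
  refine tendsto_of_tendsto_of_tendsto_of_le_of_le' hl tendsto_const_nhds ?_ ?_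
  · filter_upwards [eventually_gt_atTop 0] with x hx
    have hG := Real.Gamma_pos_of_pos hx
    have hxs : 0 < x + s := by linarith
    have h := Gamma_add_le_mul_rpow hxs (show 0 ≤ 1 - s by linarith) (by linarith)
    rw [show x + s + (1 - s) = x + 1 by ring, Real.Gamma_add_one hx.ne'] at h
    rw [le_div_iff₀ (by positivity), Real.rpow_neg (by positivity),
      Real.div_rpow hxs.le hx.le, inv_div, div_mul_eq_mul_div, div_le_iff₀ (by positivity)]
    have : x ^ (1 - s) * x ^ s = x := by
      rw [← Real.rpow_add hx]; simp
    calc x ^ (1 - s) * (Real.Gamma x * x ^ s) = x ^ (1 - s) * x ^ s * Real.Gamma x := by ring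
      _ ≤ _ := by rw [this]; exact h
  · filter_upwards [eventually_gt_atTop 0] with x hx
    have hG := Real.Gamma_pos_of_pos hx
    rw [div_le_one (by positivity)]
    exact Gamma_add_le_mul_rpow hx h0 h1

lemma tendsto_Gamma_add_div_of_nonneg {s : ℝ} (h0 : 0 ≤ s) :
    Tendsto (fun x : ℝ => Real.Gamma (x + s) / (Real.Gamma x * x ^ s)) atTop (𝓝 1) := by
  obtain ⟨n, hn⟩ := exists_nat_ge s
  induction n generalizing s with
  | zero => exact tendsto_Gamma_add_div_of_le_one h0 (by simp at hn; linarith)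
  | succ n ih =>
    rcases le_total s 1 with h1 | h1
    · exact tendsto_Gamma_add_div_of_le_one h0 h1
    · have h := (ih (s := s - 1) (by linarith) (by push_cast at hn; linarith)).mul
        (tendsto_add_div_rpow (s - 1) 1)
      rw [one_mul] at h
      refine h.congr' ?_
      filter_upwards [eventually_gt_atTop 0] with x hx
      have hG := Real.Gamma_pos_of_pos hx
      have hp : 0 < x ^ (s - 1) := by positivity
      rw [show x + s = x + (s - 1) + 1 by ring, Real.Gamma_add_one (by linarith), Real.rpow_one]
      have : x ^ s = x ^ (s - 1) * x := by
        rw [← Real.rpow_add_one hx.ne']; ring_nf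
      rw [this]
      field_simp

/-- `Γ(x + b) / Γ(x + c) ~ x ^ (b - c)` as `x → ∞`. -/
lemma tendsto_Gamma_add_div_Gamma_add (b c : ℝ) :
    Tendsto (fun x : ℝ => Real.Gamma (x + b) / Real.Gamma (x + c) * x ^ (c - b))
      atTop (𝓝 1) := by
  wlog h : c ≤ b generalizing b c
  · have h1 := (this c b (by linarith)).inv₀ one_ne_zero
    rw [inv_one] at h1
    refine h1.congr' ?_
    filter_upwards [eventually_gt_atTop 0] with x hx
    rw [mul_inv, inv_div, ← Real.rpow_neg hx.le, neg_sub]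
  · have h1 := (tendsto_Gamma_add_div_of_nonneg (sub_nonneg.2 h)).comp
      (tendsto_atTop_add_const_right atTop c tendsto_id)
    have h2 := h1.mul (tendsto_add_div_rpow c (b - c))
    rw [one_mul] at h2
    refine h2.congr' ?_
    filter_upwards [eventually_gt_atTop 0, eventually_gt_atTop (-c)] with x hx hxc
    have hxc' : 0 < x + c := by linarith
    have hG := Real.Gamma_pos_of_pos hxc'
    simp only [Function.comp, id]
    rw [show x + c + (b - c) = x + b by ring, show c - b = -(b - c) by ring,
      Real.rpow_neg hx.le, Real.div_rpow hxc'.le hx.le]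
    have : 0 < (x + c) ^ (b - c) := by positivity
    field_simp

/-- `∏_{k < N} (x + k) = Γ(x + N) / Γ(x)`, for a quotient of two such products. -/
lemma prod_range_add_div_add {x y : ℝ} (hx : 0 < x) (hy : 0 < y) (N : ℕ) :
    ∏ k ∈ Finset.range N, (x + k) / (y + k) =
      Real.Gamma y / Real.Gamma x * (Real.Gamma (N + x) / Real.Gamma (N + y)) := by
  have hGx := Real.Gamma_pos_of_pos hx
  have hGy := Real.Gamma_pos_of_pos hy
  induction N with
  | zero => simp; field_simp
  | succ n ih =>
    have h1 := Real.Gamma_pos_of_pos (show 0 < (n : ℝ) + x by positivity)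
    have h2 := Real.Gamma_pos_of_pos (show 0 < (n : ℝ) + y by positivity)
    rw [Finset.prod_range_succ, ih]
    push_cast
    rw [show (n : ℝ) + 1 + x = n + x + 1 by ring, show (n : ℝ) + 1 + y = n + y + 1 by ring,
      Real.Gamma_add_one (by positivity), Real.Gamma_add_one (by positivity)]
    field_simp
    ring

/-! ### Moments of real order -/

/-- The moment of real order `s` of a measure on `ℝ`, with values in `[0, ∞]`. It is used for
measures carried by `(0, ∞)`. -/
noncomputable def rpowMoment (μ : Measure ℝ) (s : ℝ) : ENNReal :=
  ∫⁻ x, ENNReal.ofReal (x ^ s) ∂μ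

lemma rpowMoment_zero (μ : Measure ℝ) [IsProbabilityMeasure μ] : rpowMoment μ 0 = 1 := by
  simp [rpowMoment]

lemma rpowMoment_ne_zero {μ : Measure ℝ} [NeZero μ] (hμ : ∀ᵐ x ∂μ, 0 < x) (s : ℝ) :
    rpowMoment μ s ≠ 0 := by
  intro h
  rw [rpowMoment, lintegral_eq_zero_iff (by fun_prop)] at h
  have : ∀ᵐ x ∂μ, False := by
    filter_upwards [h, hμ] with x h1 h2
    have := Real.rpow_pos_of_pos h2 s
    simp at h1
    linarith
  rw [ae_iff] at this
  simp at this
  exact NeZero.ne μ this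

/-- Moments are log-convex in the order, by Hölder's inequality. -/
lemma rpowMoment_convexComb_le {μ : Measure ℝ} (hμ : ∀ᵐ x ∂μ, 0 < x) (s t : ℝ) {θ : ℝ}
    (h0 : 0 ≤ θ) (h1 : θ ≤ 1) :
    rpowMoment μ ((1 - θ) * s + θ * t) ≤ rpowMoment μ s ^ (1 - θ) * rpowMoment μ t ^ θ := by
  have h := ENNReal.lintegral_mul_norm_pow_le (μ := μ)
    (f := fun x => ENNReal.ofReal (x ^ s)) (g := fun x => ENNReal.ofReal (x ^ t))
    (by fun_prop) (by fun_prop) (sub_nonneg.2 h1) h0 (by ring)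
  refine le_trans (le_of_eq ?_) h
  refine lintegral_congr_ae ?_
  filter_upwards [hμ] with x hx
  rw [ENNReal.ofReal_rpow_of_pos (by positivity), ENNReal.ofReal_rpow_of_pos (by positivity),
    ← ENNReal.ofReal_mul (by positivity), ← Real.rpow_mul hx.le, ← Real.rpow_mul hx.le,
    ← Real.rpow_add hx]
  ring_nf

lemma integrable_exp_mul_log {μ : Measure ℝ} (hμ : ∀ᵐ x ∂μ, 0 < x) {t : ℝ}
    (h : rpowMoment μ t ≠ ⊤) : Integrable (fun x => Real.exp (t * Real.log x)) μ := by
  refine ⟨by fun_prop, ?_⟩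
  rw [hasFiniteIntegral_iff_ofReal (ae_of_all _ fun x => (Real.exp_pos _).le), lt_top_iff_ne_top]
  convert h using 1
  refine lintegral_congr_ae ?_
  filter_upwards [hμ] with x hx
  rw [Real.rpow_def_of_pos hx, mul_comm]

lemma mgf_log_eq_rpowMoment {μ : Measure ℝ} (hμ : ∀ᵐ x ∂μ, 0 < x) (t : ℝ) :
    mgf Real.log μ t = (rpowMoment μ t).toReal := by
  rw [mgf, integral_eq_lintegral_of_nonneg_ae (ae_of_all _ fun x => (Real.exp_pos _).le)
    (by fun_prop)]
  congr 1
  refine lintegral_congr_ae ?_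
  filter_upwards [hμ] with x hx
  rw [Real.rpow_def_of_pos hx, mul_comm]

/-- A finite measure on `(0, ∞)` is determined by its moments of order close to `0`: the complex
moment generating function of `log` is analytic in a strip around the imaginary axis. -/
lemma ext_of_rpowMoment_eq {μ ν : Measure ℝ} [IsFiniteMeasure μ] [IsFiniteMeasure ν]
    (hμ : ∀ᵐ x ∂μ, 0 < x) (hν : ∀ᵐ x ∂ν, 0 < x) {ε : ℝ} (hε : 0 < ε)
    (hfin : ∀ s ∈ Ioo (-ε) ε, rpowMoment μ s ≠ ⊤)
    (heq : ∀ s ∈ Ioo (-ε) ε, rpowMoment μ s = rpowMoment ν s) : μ = ν := by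
  have hI : ∀ {ρ : Measure ℝ}, (∀ᵐ x ∂ρ, 0 < x) →
      (∀ s ∈ Ioo (-ε) ε, rpowMoment ρ s ≠ ⊤) →
      Ioo (-ε) ε ⊆ interior (integrableExpSet Real.log ρ) := by
    intro ρ hρ h
    refine interior_maximal (fun s hs => ?_) isOpen_Ioo
    exact integrable_exp_mul_log hρ (h s hs)
  have hS1 := hI hμ hfin
  have hS2 := hI hν (fun s hs => heq s hs ▸ hfin s hs)
  have h0 : (0 : ℝ) ∈ Ioo (-ε) ε := ⟨by linarith, hε⟩
  have hEq : EqOn (complexMGF Real.log μ) (complexMGF Real.log ν)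
      {z : ℂ | z.re ∈ Ioo (-ε) ε} := by
    refine AnalyticOnNhd.eqOn_of_preconnected_of_frequently_eq
      (analyticOnNhd_complexMGF.mono fun z hz => hS1 hz)
      (analyticOnNhd_complexMGF.mono fun z hz => hS2 hz)
      ((convex_Ioo _ _).linear_preimage Complex.reLm).isPreconnected
      (z₀ := ((0 : ℝ) : ℂ)) (by simpa using hε) ?_
    have h_real : ∃ᶠ (x : ℝ) in 𝓝[≠] (0 : ℝ),
        complexMGF Real.log μ x = complexMGF Real.log ν x := by
      refine Eventually.frequently ?_
      have : Ioo (-ε) ε ∈ 𝓝[≠] (0 : ℝ) := mem_nhdsWithin_of_mem_nhds (isOpen_Ioo.mem_nhds h0)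
      filter_upwards [this] with y hy
      rw [complexMGF_ofReal, complexMGF_ofReal, mgf_log_eq_rpowMoment hμ,
        mgf_log_eq_rpowMoment hν, heq y hy]
    rw [frequently_iff_seq_forall] at h_real ⊢
    obtain ⟨xs, hx_tendsto, hx_eq⟩ := h_real
    refine ⟨fun n => xs n, ?_, fun n => ?_⟩
    · rw [tendsto_nhdsWithin_iff] at hx_tendsto ⊢
      constructor
      · exact (Complex.continuous_ofReal.tendsto 0).comp hx_tendsto.1
      · simpa using hx_tendsto.2
    · simp [hx_eq]
  have hmap : μ.map Real.log = ν.map Real.log := by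
    refine Measure.ext_of_charFun (funext fun t => ?_)
    rw [← complexMGF_mul_I (by fun_prop), ← complexMGF_mul_I (by fun_prop)]
    exact hEq (by simpa using hε)
  have hback : ∀ {ρ : Measure ℝ}, (∀ᵐ x ∂ρ, 0 < x) → (ρ.map Real.log).map Real.exp = ρ := by
    intro ρ hρ
    rw [Measure.map_map (by fun_prop) (by fun_prop)]
    conv_rhs => rw [← Measure.map_id (μ := ρ)]
    refine Measure.map_congr ?_
    filter_upwards [hρ] with x hx
    simp [Real.exp_log hx]
  rw [← hback hμ, hmap, hback hν]

/-! ### Log-convex solutions of a first order recursion -/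

/-- A log-convex solution of `F (t + a) = D t * F t` is determined asymptotically by its values on
`a ℕ`, if `D` varies slowly. -/
lemma tendsto_div_of_logConvex_recursion {F D : ℝ → ℝ} {a : ℝ} (ha : 0 < a)
    (hF : ∀ t, 0 < t → 0 < F t) (hD : ∀ t, 0 < t → 0 < D t)
    (hconv : ∀ s t θ, 0 < s → 0 < t → 0 ≤ θ → θ ≤ 1 →
      F ((1 - θ) * s + θ * t) ≤ F s ^ (1 - θ) * F t ^ θ)
    (hrec : ∀ t, 0 < t → F (t + a) = D t * F t)
    (hlim : ∀ b, Tendsto (fun x => D x / D (x + b)) atTop (𝓝 1))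
    {θ : ℝ} (h0 : 0 ≤ θ) (h1 : θ ≤ 1) :
    Tendsto (fun x => F (x + θ * a) / (F x * D x ^ θ)) atTop (𝓝 1) := by
  have hl : Tendsto (fun x => (D x / D (x + θ * a)) ^ (1 - θ)) atTop (𝓝 1) := by
    simpa using (hlim (θ * a)).rpow_const (p := 1 - θ) (Or.inl one_ne_zero)
  refine tendsto_of_tendsto_of_tendsto_of_le_of_le' hl tendsto_const_nhds ?_ ?_
  · filter_upwards [eventually_gt_atTop 0] with x hx
    have hxθ : 0 < x + θ * a := by positivity
    have hFx := hF x hx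
    have hDx := hD x hx
    have hFy := hF _ hxθ
    have hDy := hD _ hxθ
    have h := hconv (x + θ * a) (x + θ * a + a) (1 - θ) hxθ (by positivity) (by linarith)
      (by linarith)
    rw [show (1 - (1 - θ)) * (x + θ * a) + (1 - θ) * (x + θ * a + a) = x + a by ring, hrec x hx,
      hrec _ hxθ, Real.mul_rpow hDy.le hFy.le, mul_left_comm, ← Real.rpow_add hFy] at h
    simp only [sub_add_cancel, Real.rpow_one] at h
    rw [le_div_iff₀ (by positivity), Real.div_rpow hDx.le hDy.le, div_mul_eq_mul_div,
      div_le_iff₀ (by positivity)]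
    have h2 : D x ^ (1 - θ) * D x ^ θ = D x := by rw [← Real.rpow_add hDx]; simp
    calc D x ^ (1 - θ) * (F x * D x ^ θ) = D x ^ (1 - θ) * D x ^ θ * F x := by ring
      _ ≤ _ := by rw [h2, mul_comm (F _)]; exact h
  · filter_upwards [eventually_gt_atTop 0] with x hx
    have hFx := hF x hx
    have hDx := hD x hx
    have h := hconv x (x + a) θ hx (by positivity) h0 h1
    rw [show (1 - θ) * x + θ * (x + a) = x + θ * a by ring, hrec x hx,
      Real.mul_rpow hDx.le hFx.le, mul_left_comm, ← Real.rpow_add hFx] at h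
    simp only [sub_add_cancel, Real.rpow_one] at h
    rw [div_le_one (by positivity), mul_comm (F x)]
    exact h

/-- Uniqueness of the log-convex solution of `F (t + a) = D t * F t`, in the manner of Bohr,
Mollerup and Webster. -/
lemma eq_of_logConvex_recursion {F G D : ℝ → ℝ} {a : ℝ} (ha : 0 < a)
    (hF : ∀ t, 0 < t → 0 < F t) (hG : ∀ t, 0 < t → 0 < G t) (hD : ∀ t, 0 < t → 0 < D t)
    (hFconv : ∀ s t θ, 0 < s → 0 < t → 0 ≤ θ → θ ≤ 1 →
      F ((1 - θ) * s + θ * t) ≤ F s ^ (1 - θ) * F t ^ θ)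
    (hGconv : ∀ s t θ, 0 < s → 0 < t → 0 ≤ θ → θ ≤ 1 →
      G ((1 - θ) * s + θ * t) ≤ G s ^ (1 - θ) * G t ^ θ)
    (hFrec : ∀ t, 0 < t → F (t + a) = D t * F t) (hGrec : ∀ t, 0 < t → G (t + a) = D t * G t)
    (hlim : ∀ b, Tendsto (fun x => D x / D (x + b)) atTop (𝓝 1)) (hFG : F a = G a)
    {t : ℝ} (ht : 0 < t) : F t = G t := by
  have hper : ∀ x, 0 < x → ∀ n : ℕ, F (x + n * a) / G (x + n * a) = F x / G x := by
    intro x hx n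
    induction n with
    | zero => simp
    | succ n ih =>
      have hxn : 0 < x + n * a := by positivity
      have := hD _ hxn
      rw [show x + ((n + 1 : ℕ) : ℝ) * a = x + n * a + a by push_cast; ring, hFrec _ hxn,
        hGrec _ hxn, mul_div_mul_left _ _ this.ne', ih]
  set θ := Int.fract (t / a) with hθ
  set k := ⌊t / a⌋₊ with hk
  have ht' : t = k * a + θ * a := by
    have : (k : ℝ) + θ = t / a := by
      rw [hk, hθ, ← Int.self_sub_floor, ← natCast_floor_eq_intCast_floor (by positivity)]; ring
    rw [← add_mul, this]; field_simp
  have h0 : 0 ≤ θ := Int.fract_nonneg _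
  have h1 : θ ≤ 1 := (Int.fract_lt_one _).le
  have hna : Tendsto (fun n : ℕ => ((n : ℝ) + 1 + k) * a) atTop atTop :=
    Tendsto.atTop_mul_const ha (tendsto_atTop_add_const_right _ _
      (tendsto_atTop_add_const_right _ _ tendsto_natCast_atTop_atTop))
  have hFl := (tendsto_div_of_logConvex_recursion ha hF hD hFconv hFrec hlim h0 h1).comp hna
  have hGl := (tendsto_div_of_logConvex_recursion ha hG hD hGconv hGrec hlim h0 h1).comp hna
  have hq := hFl.div hGl one_ne_zero
  rw [div_one] at hq
  have hc : ∀ n : ℕ, F t / G t = (((fun x => F (x + θ * a) / (F x * D x ^ θ)) ∘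
      fun n : ℕ => ((n : ℝ) + 1 + k) * a) / ((fun x => G (x + θ * a) / (G x * D x ^ θ)) ∘
      fun n : ℕ => ((n : ℝ) + 1 + k) * a)) n := by
    intro n
    simp only [Pi.div_apply, Function.comp]
    have hx : 0 < ((n : ℝ) + 1 + k) * a := by positivity
    have e1 : F (((n : ℝ) + 1 + k) * a) = G (((n : ℝ) + 1 + k) * a) := by
      have h := hper a ha (n + k)
      rw [hFG, div_self (hG a ha).ne', div_eq_one_iff_eq
        (hG _ (by positivity)).ne'] at h
      convert h using 2 <;> push_cast <;> ring
    have e2 := hper t ht (n + 1)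
    have e3 : ((n : ℝ) + 1 + k) * a + θ * a = t + (n + 1 : ℕ) * a := by
      rw [ht']; push_cast; ring
    have hGx := hG _ hx
    have hDx := Real.rpow_pos_of_pos (hD _ hx) θ
    rw [e3, e1, div_div_div_cancel_right₀ (by positivity), e2]
  have := tendsto_nhds_unique (tendsto_const_nhds.congr hc) hq
  rwa [div_eq_one_iff_eq (hG t ht).ne'] at this

/-! ### The moment recursion -/

/-- The recursion `E X^(a - t) = Γ(t) / Γ(t + α) * E X^(-t)`, `t > 0`, that the equation
`I^α f = x^(a + α) f` imposes on the moments of the law with density `f`. -/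
def MomentRecursion (α a : ℝ) (μ : Measure ℝ) : Prop :=
  ∀ t, 0 < t → rpowMoment μ (a - t) =
    ENNReal.ofReal (Real.Gamma t / Real.Gamma (t + α)) * rpowMoment μ (-t)

lemma MomentRecursion.ne_top_iff {α a : ℝ} (hα : 0 < α) {μ : Measure ℝ}
    (h : MomentRecursion α a μ) {t : ℝ} (ht : 0 < t) :
    rpowMoment μ (a - t) ≠ ⊤ ↔ rpowMoment μ (-t) ≠ ⊤ := by
  have hG := Real.Gamma_pos_of_pos ht
  have hG' := Real.Gamma_pos_of_pos (add_pos ht hα)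
  have : ENNReal.ofReal (Real.Gamma t / Real.Gamma (t + α)) ≠ 0 := by
    simp; positivity
  rw [h t ht, not_iff_not, ENNReal.mul_eq_top]
  simp [this]

/-- The recursion makes all moments of order less than `a` finite. -/
lemma MomentRecursion.ne_top {α a : ℝ} (hα : 0 < α) (ha : 0 < a) {μ : Measure ℝ}
    [IsProbabilityMeasure μ] (hμ : ∀ᵐ x ∂μ, 0 < x)
    (h : MomentRecursion α a μ) {s : ℝ} (hs : s < a) : rpowMoment μ s ≠ ⊤ := by
  have hn : ∀ n : ℕ, rpowMoment μ (-(n * a)) ≠ ⊤ := by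
    intro n
    induction n with
    | zero => simp [rpowMoment_zero]
    | succ n ih =>
      have := (h.ne_top_iff hα (t := (n + 1) * a) (by positivity)).1
        (by convert ih using 2; ring)
      push_cast
      exact this
  have hneg : ∀ s, s ≤ 0 → rpowMoment μ s ≠ ⊤ := by
    intro s hs
    obtain ⟨n, hn'⟩ := exists_nat_ge (-s / a)
    rw [div_le_iff₀ ha] at hn'
    have hle : rpowMoment μ s ≤ rpowMoment μ 0 + rpowMoment μ (-(n * a)) := by
      rw [rpowMoment, rpowMoment, rpowMoment, ← lintegral_add_left (by fun_prop)]
      refine lintegral_mono_ae ?_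
      filter_upwards [hμ] with x hx
      rw [← ENNReal.ofReal_add (by positivity) (by positivity)]
      refine ENNReal.ofReal_le_ofReal ?_
      rcases le_total x 1 with h1 | h1
      · have := Real.rpow_le_rpow_of_exponent_ge hx h1 (show -(n * a) ≤ s by linarith)
        exact this.trans (le_add_of_nonneg_left (by positivity))
      · have := Real.rpow_le_rpow_of_exponent_le h1 hs
        exact this.trans (le_add_of_nonneg_right (by positivity))
    refine ne_top_of_le_ne_top ?_ hle
    simp [rpowMoment_zero, hn n]
  have := (h.ne_top_iff hα (t := a - s) (by linarith)).2 (hneg _ (by linarith))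
  simpa using this

/-- The moment recursion has at most one solution among the laws on `(0, ∞)`. -/
lemma MomentRecursion.unique {α a : ℝ} (hα : 0 < α) (ha : 0 < a) {μ ν : Measure ℝ}
    [IsProbabilityMeasure μ] [IsProbabilityMeasure ν] (hμ : ∀ᵐ x ∂μ, 0 < x)
    (hν : ∀ᵐ x ∂ν, 0 < x) (h : MomentRecursion α a μ) (h' : MomentRecursion α a ν) : μ = ν := by
  have key : ∀ s, s < a → rpowMoment μ s = rpowMoment ν s := by
    have hpos : ∀ {ρ : Measure ℝ} [IsProbabilityMeasure ρ], (∀ᵐ x ∂ρ, 0 < x) →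
        MomentRecursion α a ρ → ∀ t, 0 < t → 0 < (rpowMoment ρ (a - t)).toReal :=
      fun hρ hr t ht => ENNReal.toReal_pos (rpowMoment_ne_zero hρ _)
        (hr.ne_top hα ha hρ (by linarith))
    have hcv : ∀ {ρ : Measure ℝ} [IsProbabilityMeasure ρ], (∀ᵐ x ∂ρ, 0 < x) →
        MomentRecursion α a ρ → ∀ s t θ, 0 < s → 0 < t → 0 ≤ θ → θ ≤ 1 →
        (rpowMoment ρ (a - ((1 - θ) * s + θ * t))).toReal ≤
          (rpowMoment ρ (a - s)).toReal ^ (1 - θ) * (rpowMoment ρ (a - t)).toReal ^ θ := by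
      intro ρ _ hρ hr s t θ hs ht h0 h1
      have hle := rpowMoment_convexComb_le hρ (a - s) (a - t) h0 h1
      rw [show (1 - θ) * (a - s) + θ * (a - t) = a - ((1 - θ) * s + θ * t) by ring] at hle
      rw [ENNReal.toReal_rpow, ENNReal.toReal_rpow, ← ENNReal.toReal_mul]
      refine ENNReal.toReal_mono ?_ hle
      exact ENNReal.mul_ne_top
        (ENNReal.rpow_ne_top_of_nonneg (by linarith) (hr.ne_top hα ha hρ (by linarith)))
        (ENNReal.rpow_ne_top_of_nonneg h0 (hr.ne_top hα ha hρ (by linarith)))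
    have hrec : ∀ {ρ : Measure ℝ} [IsProbabilityMeasure ρ], (∀ᵐ x ∂ρ, 0 < x) →
        MomentRecursion α a ρ → ∀ t, 0 < t → (rpowMoment ρ (a - (t + a))).toReal =
          Real.Gamma (t + α) / Real.Gamma t * (rpowMoment ρ (a - t)).toReal := by
      intro ρ _ hρ hr t ht
      have hG := Real.Gamma_pos_of_pos ht
      have hG' := Real.Gamma_pos_of_pos (add_pos ht hα)
      rw [hr t ht, ENNReal.toReal_mul, ENNReal.toReal_ofReal (by positivity),
        show a - (t + a) = -t by ring]
      field_simp
    intro s hs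
    have := eq_of_logConvex_recursion (D := fun t => Real.Gamma (t + α) / Real.Gamma t)
      (F := fun t => (rpowMoment μ (a - t)).toReal) (G := fun t => (rpowMoment ν (a - t)).toReal)
      ha (hpos hμ h) (hpos hν h')
      (fun t ht => div_pos (Real.Gamma_pos_of_pos (add_pos ht hα)) (Real.Gamma_pos_of_pos ht))
      (hcv hμ h) (hcv hν h') (hrec hμ h) (hrec hν h') ?_ (by simp [rpowMoment_zero])
      (t := a - s) (by linarith)
    · simp only [sub_sub_cancel] at this
      exact (ENNReal.toReal_eq_toReal_iff' (h.ne_top hα ha hμ hs) (h'.ne_top hα ha hν hs)).1 this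
    · intro b
      have h1 := (tendsto_Gamma_add_div_Gamma_add α 0).div
        (tendsto_Gamma_add_div_Gamma_add (b + α) b) one_ne_zero
      rw [div_one] at h1
      refine h1.congr' ?_
      filter_upwards [eventually_gt_atTop 0, eventually_gt_atTop (-b)] with x hx hxb
      have h2 := Real.Gamma_pos_of_pos (show 0 < x + b by linarith)
      have h3 := Real.Gamma_pos_of_pos (show 0 < x + b + α by linarith)
      have h4 := Real.Gamma_pos_of_pos hx
      have h5 := Real.rpow_pos_of_pos hx (-α)
      simp only [Pi.div_apply, add_zero, zero_sub, ← add_assoc]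
      rw [show b - (b + α) = -α by ring, mul_div_mul_right _ _ h5.ne']
  exact ext_of_rpowMoment_eq hμ hν ha (fun s hs => h.ne_top hα ha hμ hs.2)
    (fun s hs => key s hs.2)

/-! ### The fractional integral of a measure and its Laplace transform -/

lemma lintegral_rpow_mul_exp_neg_mul {p l : ℝ} (hp : 0 < p) (hl : 0 < l) :
    ∫⁻ x in Ioi (0 : ℝ), ENNReal.ofReal (x ^ (p - 1) * Real.exp (-(l * x))) =
      ENNReal.ofReal (Real.Gamma p * l ^ (-p)) := by
  have hG := Real.Gamma_pos_of_pos hp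
  have h := Real.integral_rpow_mul_exp_neg_mul_Ioi hp hl
  have hne : (1 / l) ^ p * Real.Gamma p ≠ 0 := by positivity
  rw [← ofReal_integral_eq_lintegral_ofReal, h, one_div, Real.inv_rpow hl.le,
    Real.rpow_neg hl.le, mul_comm]
  · by_contra hcon
    rw [integral_undef hcon] at h
    exact hne h.symm
  · filter_upwards [ae_restrict_mem measurableSet_Ioi] with x hx
    have : (0 : ℝ) < x := hx
    positivity

/-- Averaging Laplace transforms over `l ^ (p - 1) dl` gives the moment of order `-p`. -/
lemma lintegral_rpow_mul_laplace {μ : Measure ℝ} [SFinite μ] (hμ : ∀ᵐ x ∂μ, 0 < x) {p : ℝ}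
    (hp : 0 < p) {w : ℝ → ENNReal} (hw : Measurable w) :
    ∫⁻ l in Ioi (0 : ℝ), ENNReal.ofReal (l ^ (p - 1)) *
        ∫⁻ x, ENNReal.ofReal (Real.exp (-(l * x))) * w x ∂μ =
      ENNReal.ofReal (Real.Gamma p) * ∫⁻ x, ENNReal.ofReal (x ^ (-p)) * w x ∂μ := by
  have hG := Real.Gamma_pos_of_pos hp
  simp_rw [← lintegral_const_mul' _ _ ENNReal.ofReal_ne_top]
  rw [lintegral_lintegral_swap (by fun_prop)]
  refine lintegral_congr_ae ?_
  filter_upwards [hμ] with x hx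
  have h := lintegral_rpow_mul_exp_neg_mul hp hx
  rw [← mul_assoc, ← ENNReal.ofReal_mul hG.le, ← h, ← lintegral_mul_const _ (by fun_prop)]
  refine setLIntegral_congr_fun measurableSet_Ioi fun l hl => ?_
  have hl : (0 : ℝ) < l := hl
  rw [← mul_assoc, ← ENNReal.ofReal_mul (by positivity), mul_comm l x]

/-- The fractional integral of order `α` of a measure on `(0, ∞)`, as a function with values in
`[0, ∞]`. -/
noncomputable def fracIntegral (α : ℝ) (μ : Measure ℝ) (x : ℝ) : ENNReal :=
  ENNReal.ofReal (1 / Real.Gamma α) * ∫⁻ v in Ioo 0 x, ENNReal.ofReal ((x - v) ^ (α - 1)) ∂μ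

lemma fracIntegral_eq_lintegral_indicator {α : ℝ} {μ : Measure ℝ} (x : ℝ) :
    fracIntegral α μ x = ENNReal.ofReal (1 / Real.Gamma α) *
      ∫⁻ v, {z : ℝ × ℝ | z.2 ∈ Ioo 0 z.1}.indicator
        (fun z => ENNReal.ofReal ((z.1 - z.2) ^ (α - 1))) (x, v) ∂μ := by
  rw [fracIntegral, ← lintegral_indicator measurableSet_Ioo]
  rfl

lemma measurable_fracIntegral_kernel (α : ℝ) :
    Measurable ({z : ℝ × ℝ | z.2 ∈ Ioo 0 z.1}.indicator
      (fun z => ENNReal.ofReal ((z.1 - z.2) ^ (α - 1)))) := by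
  refine Measurable.indicator (by fun_prop) ?_
  exact (measurableSet_lt measurable_const measurable_snd).inter
    (measurableSet_lt measurable_snd measurable_fst)

lemma measurable_fracIntegral (α : ℝ) (μ : Measure ℝ) [SFinite μ] :
    Measurable (fracIntegral α μ) := by
  have : fracIntegral α μ = fun x => ENNReal.ofReal (1 / Real.Gamma α) *
      ∫⁻ v, {z : ℝ × ℝ | z.2 ∈ Ioo 0 z.1}.indicator
        (fun z => ENNReal.ofReal ((z.1 - z.2) ^ (α - 1))) (x, v) ∂μ :=
    funext fun x => fracIntegral_eq_lintegral_indicator x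
  rw [this]
  exact (measurable_fracIntegral_kernel α).lintegral_prod_right'.const_mul _

/-- The Laplace transform turns the fractional integral into multiplication by `l ^ (-α)`. -/
lemma laplace_fracIntegral {α l : ℝ} (hα : 0 < α) (hl : 0 < l) {μ : Measure ℝ} [SFinite μ]
    (hμ : ∀ᵐ x ∂μ, 0 < x) :
    ∫⁻ x in Ioi (0 : ℝ), ENNReal.ofReal (Real.exp (-(l * x))) * fracIntegral α μ x =
      ENNReal.ofReal (l ^ (-α)) * ∫⁻ v, ENNReal.ofReal (Real.exp (-(l * v))) ∂μ := by
  have hG := Real.Gamma_pos_of_pos hα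
  have hk := measurable_fracIntegral_kernel α
  set K := {z : ℝ × ℝ | z.2 ∈ Ioo 0 z.1}.indicator
      (fun z => ENNReal.ofReal ((z.1 - z.2) ^ (α - 1))) with hK
  have inner : ∀ v, 0 < v →
      ∫⁻ x in Ioi (0 : ℝ), ENNReal.ofReal (Real.exp (-(l * x))) * K (x, v) =
        ENNReal.ofReal (Real.Gamma α) *
          (ENNReal.ofReal (l ^ (-α)) * ENNReal.ofReal (Real.exp (-(l * v)))) := by
    intro v hv
    have e : ∀ x, (Ioi (0 : ℝ)).indicator
        (fun x => ENNReal.ofReal (Real.exp (-(l * x))) * K (x, v)) x =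
        (fun y => ENNReal.ofReal (Real.exp (-(l * v))) * (Ioi (0 : ℝ)).indicator
          (fun y => ENNReal.ofReal (y ^ (α - 1) * Real.exp (-(l * y)))) y) (x - v) := by
      intro x
      by_cases hx : v < x
      · have hx0 : 0 < x := hv.trans hx
        rw [indicator_of_mem (show x ∈ Ioi 0 from hx0), hK,
          indicator_of_mem (show (x, v) ∈ {z : ℝ × ℝ | z.2 ∈ Ioo 0 z.1} from ⟨hv, hx⟩)]
        simp only
        rw [indicator_of_mem (show x - v ∈ Ioi 0 from sub_pos.2 hx),
          ← ENNReal.ofReal_mul (by positivity), ← ENNReal.ofReal_mul (by positivity)]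
        congr 1
        rw [mul_left_comm, ← Real.exp_add, mul_comm]
        ring_nf
      · have h1 : K (x, v) = 0 := indicator_of_notMem (fun h => hx h.2) _
        have h2 : x - v ∉ Ioi (0 : ℝ) := fun h => hx (sub_pos.1 h)
        simp only [indicator_of_notMem h2, mul_zero]
        by_cases hx0 : x ∈ Ioi (0 : ℝ)
        · rw [indicator_of_mem hx0, h1, mul_zero]
        · rw [indicator_of_notMem hx0]
    rw [← lintegral_indicator measurableSet_Ioi]
    simp_rw [e]
    rw [lintegral_sub_right_eq_self (fun y => ENNReal.ofReal (Real.exp (-(l * v))) *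
        (Ioi (0 : ℝ)).indicator
          (fun y => ENNReal.ofReal (y ^ (α - 1) * Real.exp (-(l * y)))) y) v,
      lintegral_const_mul' _ _ ENNReal.ofReal_ne_top, lintegral_indicator measurableSet_Ioi,
      lintegral_rpow_mul_exp_neg_mul hα hl, ENNReal.ofReal_mul hG.le]
    ring
  simp_rw [fracIntegral_eq_lintegral_indicator, ← hK]
  calc _ = ENNReal.ofReal (1 / Real.Gamma α) * ∫⁻ x in Ioi (0 : ℝ), ∫⁻ v,
        ENNReal.ofReal (Real.exp (-(l * x))) * K (x, v) ∂μ := by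
        rw [← lintegral_const_mul' _ _ ENNReal.ofReal_ne_top]
        refine lintegral_congr fun x => ?_
        rw [lintegral_const_mul' _ _ ENNReal.ofReal_ne_top]
        ring
    _ = ENNReal.ofReal (1 / Real.Gamma α) * ∫⁻ v, ENNReal.ofReal (Real.Gamma α) *
          (ENNReal.ofReal (l ^ (-α)) * ENNReal.ofReal (Real.exp (-(l * v)))) ∂μ := by
        rw [lintegral_lintegral_swap (by fun_prop)]
        congr 1
        refine lintegral_congr_ae ?_
        filter_upwards [hμ] with v hv using inner v hv
    _ = _ := by
        rw [lintegral_const_mul' _ _ ENNReal.ofReal_ne_top,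
          lintegral_const_mul' _ _ ENNReal.ofReal_ne_top, ← mul_assoc,
          ← ENNReal.ofReal_mul (by positivity), one_div_mul_cancel hG.ne', ENNReal.ofReal_one,
          one_mul]

/-- The moments of the fractional integral of a measure. -/
lemma lintegral_rpow_mul_fracIntegral {α t : ℝ} (hα : 0 < α) (ht : 0 < t) {μ : Measure ℝ}
    [SFinite μ] (hμ : ∀ᵐ x ∂μ, 0 < x) :
    ∫⁻ x in Ioi (0 : ℝ), ENNReal.ofReal (x ^ (-(t + α))) * fracIntegral α μ x =
      ENNReal.ofReal (Real.Gamma t / Real.Gamma (t + α)) * rpowMoment μ (-t) := by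
  have hG := Real.Gamma_pos_of_pos (add_pos ht hα)
  have h1 := lintegral_rpow_mul_laplace (μ := volume.restrict (Ioi 0))
    (ae_restrict_mem measurableSet_Ioi) (add_pos ht hα) (measurable_fracIntegral α μ)
  have h2 := lintegral_rpow_mul_laplace hμ ht (w := fun _ => 1) measurable_const
  simp only [mul_one] at h2
  have h3 : ∫⁻ l in Ioi (0 : ℝ), ENNReal.ofReal (l ^ (t + α - 1)) *
      ∫⁻ x in Ioi (0 : ℝ), ENNReal.ofReal (Real.exp (-(l * x))) * fracIntegral α μ x =
      ∫⁻ l in Ioi (0 : ℝ), ENNReal.ofReal (l ^ (t - 1)) *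
        ∫⁻ x, ENNReal.ofReal (Real.exp (-(l * x))) ∂μ := by
    refine setLIntegral_congr_fun measurableSet_Ioi fun l hl => ?_
    have hl : (0 : ℝ) < l := hl
    rw [laplace_fracIntegral hα hl hμ, ← mul_assoc, ← ENNReal.ofReal_mul (by positivity),
      ← Real.rpow_add hl]
    ring_nf
  rw [h3, h2] at h1
  rw [div_eq_inv_mul, ENNReal.ofReal_mul (by positivity), mul_assoc, rpowMoment, h1, ← mul_assoc,
    ← ENNReal.ofReal_mul (by positivity), inv_mul_cancel₀ hG.ne', ENNReal.ofReal_one, one_mul]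

/-! ### The equation in terms of the law with density `f` -/

lemma IsPositiveDensity.isProbabilityMeasure {f : ℝ → ℝ} (hf : IsPositiveDensity f) :
    IsProbabilityMeasure (densityLaw f) where
  measure_univ := by
    rw [densityLaw, withDensity_apply _ MeasurableSet.univ, Measure.restrict_univ]
    exact hf.lintegral_eq_one

lemma densityLaw_pos (f : ℝ → ℝ) : ∀ᵐ x ∂densityLaw f, 0 < x :=
  (withDensity_absolutelyContinuous _ _).ae_le (ae_restrict_mem measurableSet_Ioi)

lemma IsPositiveDensity.lintegral_densityLaw {f : ℝ → ℝ} (hf : IsPositiveDensity f)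
    {g : ℝ → ENNReal} (hg : Measurable g) :
    ∫⁻ x, g x ∂densityLaw f = ∫⁻ x in Ioi (0 : ℝ), g x * ENNReal.ofReal (f x) := by
  rw [densityLaw, lintegral_withDensity_eq_lintegral_mul₀ hf.aemeasurable.ennreal_ofReal
    hg.aemeasurable]
  refine lintegral_congr fun x => ?_
  simp [mul_comm]

lemma IsPositiveDensity.setLIntegral_densityLaw {f : ℝ → ℝ} (hf : IsPositiveDensity f)
    {g : ℝ → ENNReal} (hg : Measurable g) (x : ℝ) :
    ∫⁻ v in Ioo 0 x, g v ∂densityLaw f = ∫⁻ v in Ioo 0 x, g v * ENNReal.ofReal (f v) := by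
  rw [← lintegral_indicator measurableSet_Ioo,
    hf.lintegral_densityLaw (hg.indicator measurableSet_Ioo)]
  simp_rw [← Set.indicator_mul_left (Ioo 0 x) g (fun v => ENNReal.ofReal (f v))]
  rw [lintegral_indicator measurableSet_Ioo, Measure.restrict_restrict measurableSet_Ioo]
  congr 2
  exact inter_eq_left.2 fun v hv => hv.1

/-- The pointwise equation says that the fractional integral of the law with density `f` is finite
and equal to `x ^ m * f x`. -/
lemma IsPositiveDensity.solvesAt_iff {f : ℝ → ℝ} (hf : IsPositiveDensity f) {α m x : ℝ}
    (hα : 0 < α) :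
    SolvesAt α m f x ↔ fracIntegral α (densityLaw f) x ≠ ⊤ ∧
      x ^ m * f x = (fracIntegral α (densityLaw f) x).toReal := by
  have hG := Real.Gamma_pos_of_pos hα
  have hsub : volume.restrict (Ioo 0 x) ≤ volume.restrict (Ioi (0 : ℝ)) :=
    Measure.restrict_mono_set _ fun v hv => hv.1
  have hnn : 0 ≤ᵐ[volume.restrict (Ioo 0 x)] fun v => (x - v) ^ (α - 1) * f v := by
    filter_upwards [ae_mono hsub hf.nonneg, ae_restrict_mem measurableSet_Ioo] with v h1 h2
    have : 0 < x - v := sub_pos.2 h2.2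
    simp only [Pi.zero_apply]
    positivity
  have hm : AEStronglyMeasurable (fun v => (x - v) ^ (α - 1) * f v)
      (volume.restrict (Ioo 0 x)) :=
    (AEMeasurable.mul (by fun_prop) (hf.aemeasurable.mono_measure hsub)).aestronglyMeasurable
  have hF : fracIntegral α (densityLaw f) x = ENNReal.ofReal (1 / Real.Gamma α) *
      ∫⁻ v in Ioo 0 x, ENNReal.ofReal ((x - v) ^ (α - 1) * f v) := by
    rw [fracIntegral, hf.setLIntegral_densityLaw (by fun_prop)]
    congr 1
    refine setLIntegral_congr_fun measurableSet_Ioo fun v hv => ?_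
    have : 0 < x - v := sub_pos.2 hv.2
    rw [← ENNReal.ofReal_mul (by positivity)]
  have h0 : ENNReal.ofReal (1 / Real.Gamma α) ≠ 0 := by simpa using hG
  have hint : IntegrableOn (fun v => (x - v) ^ (α - 1) * f v) (Ioo 0 x) ↔
      fracIntegral α (densityLaw f) x ≠ ⊤ := by
    rw [hF, IntegrableOn, Integrable, hasFiniteIntegral_iff_ofReal hnn, lt_top_iff_ne_top,
      Ne, Ne, ENNReal.mul_eq_top]
    simp only [h0, hm, ENNReal.ofReal_ne_top, ne_eq, not_false_eq_true, true_and, false_and,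
      or_false]
  have hRL : riemannLiouville α f x = (fracIntegral α (densityLaw f) x).toReal := by
    rw [riemannLiouville, integral_eq_lintegral_of_nonneg_ae hnn hm, hF, ENNReal.toReal_mul,
      ENNReal.toReal_ofReal (by positivity)]
  rw [SolvesAt, hint, hRL]

lemma IsDensitySolution.isAEDensitySolution {α m : ℝ} {f : ℝ → ℝ} (hf : IsDensitySolution α m f) :
    IsAEDensitySolution α m f :=
  ⟨hf.density, (ae_restrict_mem measurableSet_Ioi).mono hf.solves⟩

/-- The equation for `f`, in terms of Laplace transforms. -/
lemma IsAEDensitySolution.laplace_eq {α m : ℝ} (hα : 0 < α) {f : ℝ → ℝ}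
    (hf : IsAEDensitySolution α m f) {l : ℝ} (hl : 0 < l) :
    ∫⁻ x, ENNReal.ofReal (Real.exp (-(l * x))) * ENNReal.ofReal (x ^ m) ∂densityLaw f =
      ENNReal.ofReal (l ^ (-α)) * ∫⁻ x, ENNReal.ofReal (Real.exp (-(l * x))) ∂densityLaw f := by
  have := hf.density.isProbabilityMeasure
  rw [← laplace_fracIntegral hα hl (densityLaw_pos f),
    hf.density.lintegral_densityLaw (by fun_prop)]
  refine lintegral_congr_ae ?_
  filter_upwards [hf.solves, ae_restrict_mem measurableSet_Ioi] with x hs hx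
  have hx : (0 : ℝ) < x := hx
  obtain ⟨h1, h2⟩ := (hf.density.solvesAt_iff hα).1 hs
  rw [mul_assoc, ← ENNReal.ofReal_mul (by positivity), h2, ENNReal.ofReal_toReal h1]

/-- The equation for `f` gives the moment recursion for the law with density `f`. -/
lemma IsAEDensitySolution.momentRecursion {α m : ℝ} (hα : 0 < α) {f : ℝ → ℝ}
    (hf : IsAEDensitySolution α m f) : MomentRecursion α (m - α) (densityLaw f) := by
  intro t ht
  have := hf.density.isProbabilityMeasure
  have hpos := densityLaw_pos f
  rw [← lintegral_rpow_mul_fracIntegral hα ht hpos, rpowMoment,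
    hf.density.lintegral_densityLaw (by fun_prop)]
  refine lintegral_congr_ae ?_
  filter_upwards [hf.solves, ae_restrict_mem measurableSet_Ioi] with x hs hx
  have hx : (0 : ℝ) < x := hx
  obtain ⟨h1, h2⟩ := (hf.density.solvesAt_iff hα).1 hs
  rw [← ENNReal.ofReal_toReal h1, ← h2, ENNReal.ofReal_mul (by positivity), ← mul_assoc,
    ← ENNReal.ofReal_mul (p := x ^ (-(t + α))) (by positivity), ← Real.rpow_add hx]
  ring_nf

/-! ### Necessity of `α < m` -/

/-- A law whose Laplace transform `L` satisfies `E (X ^ m e ^ (-l X)) = l ^ (-α) L(l)` forces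
`m > 0`: compare `l = 1` with `l = 2`. For `m ≤ 0`, tilting by `e ^ (-X)` favours small values of
`X`, hence large values of `X ^ m`, whereas `l ^ (-α)` decreases. -/
lemma pos_of_laplace_eq {α m : ℝ} (hα : 0 < α) {μ : Measure ℝ} [IsProbabilityMeasure μ]
    (hμ : ∀ᵐ x ∂μ, 0 < x)
    (hL : ∀ l : ℝ, 0 < l →
      ∫⁻ x, ENNReal.ofReal (Real.exp (-(l * x))) * ENNReal.ofReal (x ^ m) ∂μ =
      ENNReal.ofReal (l ^ (-α)) * ∫⁻ x, ENNReal.ofReal (Real.exp (-(l * x))) ∂μ) : 0 < m := by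
  by_contra! hm
  have hfin : ∀ l : ℝ, 0 < l → ∫⁻ x, ENNReal.ofReal (Real.exp (-(l * x))) ∂μ ≠ ⊤ := by
    intro l hl
    refine ne_top_of_le_ne_top (b := 1) (by simp) ?_
    calc _ ≤ ∫⁻ _, 1 ∂μ := by
          refine lintegral_mono_ae ?_
          filter_upwards [hμ] with x hx
          rw [ENNReal.ofReal_le_one, Real.exp_le_one_iff]
          nlinarith
      _ = 1 := by simp
  have h1 := hL 1 one_pos
  have h2 := hL 2 two_pos
  set L1 := ∫⁻ x, ENNReal.ofReal (Real.exp (-(1 * x))) ∂μ with hL1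
  set L2 := ∫⁻ x, ENNReal.ofReal (Real.exp (-(2 * x))) ∂μ with hL2
  rw [Real.one_rpow, ENNReal.ofReal_one, one_mul] at h1
  have hle : L2 + ENNReal.ofReal (Real.exp (-1)) * L1 ≤
      ENNReal.ofReal (2 ^ (-α)) * L2 + ENNReal.ofReal (Real.exp (-1)) * L1 := by
    conv_lhs => rw [← h1]
    conv_rhs => rw [← h2]
    rw [hL1, hL2, ← lintegral_const_mul _ (by fun_prop), ← lintegral_const_mul _ (by fun_prop),
      ← lintegral_add_left (by fun_prop), ← lintegral_add_left (by fun_prop)]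
    refine lintegral_mono_ae ?_
    filter_upwards [hμ] with x hx
    have hxm : 0 < x ^ m := by positivity
    rw [← ENNReal.ofReal_mul (by positivity), ← ENNReal.ofReal_mul (by positivity),
      ← ENNReal.ofReal_mul (by positivity), ← ENNReal.ofReal_mul (by positivity),
      ← ENNReal.ofReal_add (by positivity) (by positivity),
      ← ENNReal.ofReal_add (by positivity) (by positivity)]
    refine ENNReal.ofReal_le_ofReal ?_
    have e2 : Real.exp (-(2 * x)) = Real.exp (-x) * Real.exp (-x) := by
      rw [← Real.exp_add]; ring_nf
    rw [e2, one_mul]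
    -- both factors are nonnegative for `x ≤ 1` and nonpositive for `1 ≤ x`
    have hsign : 0 ≤ (x ^ m - 1) * (Real.exp (-x) - Real.exp (-1)) := by
      rcases le_total x 1 with h | h
      · exact mul_nonneg (sub_nonneg.2 (Real.one_le_rpow_of_pos_of_le_one_of_nonpos hx h hm))
          (sub_nonneg.2 (Real.exp_le_exp.2 (by linarith)))
      · exact mul_nonneg_of_nonpos_of_nonpos
          (sub_nonpos.2 (Real.rpow_le_one_of_one_le_of_nonpos h hm))
          (sub_nonpos.2 (Real.exp_le_exp.2 (by linarith)))
    have := mul_nonneg (Real.exp_pos (-x)).le hsign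
    linarith
  have hle' : L2 ≤ ENNReal.ofReal (2 ^ (-α)) * L2 :=
    (ENNReal.add_le_add_iff_right
      (ENNReal.mul_ne_top ENNReal.ofReal_ne_top (hfin 1 one_pos))).1 hle
  have hpos2 : L2 ≠ 0 := by
    rw [hL2, Ne, lintegral_eq_zero_iff (by fun_prop)]
    intro h
    have : ∀ᵐ x ∂μ, False := by
      filter_upwards [h] with x h1
      have := Real.exp_pos (-(2 * x))
      simp at h1
      linarith
    rw [ae_iff] at this
    simp at this
  have hlt : ENNReal.ofReal ((2 : ℝ) ^ (-α)) < 1 := by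
    rw [ENNReal.ofReal_lt_one]
    exact Real.rpow_lt_one_of_one_lt_of_neg one_lt_two (by linarith)
  have := ENNReal.mul_lt_mul_left hpos2 (hfin 2 two_pos) hlt
  rw [one_mul] at this
  exact absurd hle' (not_le.2 this)

/-- Behaviour of the Laplace transform identity at `l → 0`: `E ((l X) ^ m e ^ (-l X))` tends to `0`,
and it equals `l ^ (m - α) L(l)`, where `L(l)` tends to `1`. -/
lemma lt_of_laplace_eq {α m : ℝ} (hα : 0 < α) {μ : Measure ℝ} [IsProbabilityMeasure μ]
    (hμ : ∀ᵐ x ∂μ, 0 < x)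
    (hL : ∀ l : ℝ, 0 < l →
      ∫⁻ x, ENNReal.ofReal (Real.exp (-(l * x))) * ENNReal.ofReal (x ^ m) ∂μ =
      ENNReal.ofReal (l ^ (-α)) * ∫⁻ x, ENNReal.ofReal (Real.exp (-(l * x))) ∂μ) : α < m := by
  have hm := pos_of_laplace_eq hα hμ hL
  by_contra! hle
  set l : ℕ → ℝ := fun n => 1 / ((n : ℝ) + 1) with hl
  have hl0 : ∀ n, 0 < l n := fun n => by positivity
  have hl1 : ∀ n, l n ≤ 1 := fun n => by
    rw [hl]; simp only; rw [div_le_one (by positivity)]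
    have : (0 : ℝ) ≤ n := by positivity
    linarith
  have hlim : Tendsto l atTop (𝓝 0) := tendsto_one_div_add_atTop_nhds_zero_nat
  have t1 : Tendsto (fun n => ∫⁻ x, ENNReal.ofReal (Real.exp (-(l n * x))) ∂μ) atTop (𝓝 1) := by
    have : (1 : ENNReal) = ∫⁻ _, 1 ∂μ := by simp
    rw [this]
    refine tendsto_lintegral_of_dominated_convergence (fun _ => 1) (fun n => by fun_prop)
      (fun n => ?_) (by simp) ?_
    · filter_upwards [hμ] with x hx
      rw [ENNReal.ofReal_le_one, Real.exp_le_one_iff]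
      have := mul_pos (hl0 n) hx
      linarith
    · refine ae_of_all _ fun x => ?_
      have h : Tendsto (fun n => Real.exp (-(l n * x))) atTop (𝓝 (Real.exp (-(0 * x)))) :=
        (Real.continuous_exp.tendsto _).comp (hlim.mul_const x).neg
      simpa using ENNReal.tendsto_ofReal h
  have t0 : Tendsto (fun n => ∫⁻ x, ENNReal.ofReal ((l n * x) ^ m * Real.exp (-(l n * x))) ∂μ)
      atTop (𝓝 0) := by
    have : (0 : ENNReal) = ∫⁻ _, 0 ∂μ := by simp
    rw [this]
    refine tendsto_lintegral_of_dominated_convergence (fun _ => ENNReal.ofReal (m ^ m))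
      (fun n => by fun_prop) (fun n => ?_) (by simp) ?_
    · filter_upwards [hμ] with x hx
      refine ENNReal.ofReal_le_ofReal ?_
      set y := l n * x
      have hy : 0 < y := mul_pos (hl0 n) hx
      -- `y / m ≤ e ^ (y / m)`, raised to the power `m`
      have h : y / m ≤ Real.exp (y / m) := by linarith [Real.add_one_le_exp (y / m)]
      have h2 := Real.rpow_le_rpow (by positivity) h hm.le
      rw [← Real.exp_mul, div_mul_cancel₀ _ hm.ne', Real.div_rpow hy.le hm.le,
        div_le_iff₀ (by positivity)] at h2
      rw [Real.exp_neg, ← div_eq_mul_inv, div_le_iff₀ (Real.exp_pos _), mul_comm]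
      exact h2
    · filter_upwards [hμ] with x hx
      have h0 : Tendsto (fun n => l n * x) atTop (𝓝 0) := by simpa using hlim.mul_const x
      have h1 : Tendsto (fun n => (l n * x) ^ m) atTop (𝓝 0) := by
        simpa [Real.zero_rpow hm.ne'] using h0.rpow_const (p := m) (Or.inr hm.le)
      have h2 : Tendsto (fun n => Real.exp (-(l n * x))) atTop (𝓝 1) := by
        simpa [Function.comp_def] using (Real.continuous_exp.tendsto _).comp h0.neg
      simpa using ENNReal.tendsto_ofReal (h1.mul h2)
  have hcmp : ∀ n, ∫⁻ x, ENNReal.ofReal (Real.exp (-(l n * x))) ∂μ ≤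
      ∫⁻ x, ENNReal.ofReal ((l n * x) ^ m * Real.exp (-(l n * x))) ∂μ := by
    intro n
    have hn := hl0 n
    have e : ∫⁻ x, ENNReal.ofReal ((l n * x) ^ m * Real.exp (-(l n * x))) ∂μ =
        ENNReal.ofReal (l n ^ m) *
          ∫⁻ x, ENNReal.ofReal (Real.exp (-(l n * x))) * ENNReal.ofReal (x ^ m) ∂μ := by
      rw [← lintegral_const_mul _ (by fun_prop)]
      refine lintegral_congr_ae ?_
      filter_upwards [hμ] with x hx
      rw [← ENNReal.ofReal_mul (by positivity), ← ENNReal.ofReal_mul (by positivity),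
        Real.mul_rpow hn.le hx.le]
      ring_nf
    rw [e, hL _ hn, ← mul_assoc, ← ENNReal.ofReal_mul (by positivity), ← Real.rpow_add hn]
    refine le_mul_of_one_le_left' ?_
    rw [ENNReal.one_le_ofReal]
    exact Real.one_le_rpow_of_pos_of_le_one_of_nonpos hn (hl1 n) (by linarith)
  have := le_of_tendsto_of_tendsto' t1 t0 hcmp
  simp at this

/-! ### Infinite products of independent positive random variables -/

/-- The partial products of independent nonnegative random variables of mean one form a bounded
martingale in `L¹`, hence converge almost surely. -/
lemma ProbabilityTheory.iIndepFun.exists_tendsto_prod {Ω : Type*} [MeasurableSpace Ω]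
    {P : Measure Ω} [IsProbabilityMeasure P] {Y : ℕ → Ω → ℝ} (hind : iIndepFun Y P)
    (hm : ∀ n, Measurable (Y n)) (hpos : ∀ n, ∀ᵐ ω ∂P, 0 < Y n ω)
    (hmean : ∀ n, ∫⁻ ω, ENNReal.ofReal (Y n ω) ∂P = 1) :
    ∃ Z : Ω → ℝ, AEMeasurable Z P ∧
      ∀ᵐ ω ∂P, Tendsto (fun N => ∏ n ∈ Finset.range N, Y n ω) atTop (𝓝 (Z ω)) := by
  have hint : ∀ n, Integrable (Y n) P := fun n => by
    refine ⟨(hm n).aestronglyMeasurable, ?_⟩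
    rw [hasFiniteIntegral_iff_ofReal ((hpos n).mono fun _ h => h.le), hmean]
    exact ENNReal.one_lt_top
  have hintegral : ∀ n, ∫ ω, Y n ω ∂P = 1 := fun n => by
    rw [integral_eq_lintegral_of_nonneg_ae ((hpos n).mono fun _ h => h.le)
      (hm n).aestronglyMeasurable, hmean]
    simp
  have hI : ∀ N, Integrable (∏ n ∈ Finset.range N, Y n) P := by
    intro N
    induction N with
    | zero => exact integrable_const (1 : ℝ)
    | succ N ih =>
      rw [Finset.prod_range_succ]
      exact (hind.indepFun_prod_range_succ hm N).integrable_mul ih (hint N)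
  have hpos' : ∀ᵐ ω ∂P, ∀ n, 0 < Y n ω := ae_all_iff.2 hpos
  set ℱ := Filtration.natural Y fun n => (hm n).stronglyMeasurable with hℱ
  -- `N + 1` factors: `W N` involves exactly the variables that generate `ℱ N`
  set W : ℕ → Ω → ℝ := fun N => ∏ n ∈ Finset.range (N + 1), Y n with hW
  have hadp : StronglyAdapted ℱ W := by
    intro N
    refine Finset.stronglyMeasurable_prod _ fun n hn => ?_
    exact ((Filtration.stronglyAdapted_natural fun n => (hm n).stronglyMeasurable) n).mono
      (ℱ.mono (Nat.lt_succ_iff.1 (Finset.mem_range.1 hn)))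
  have hmart : Martingale W ℱ P := by
    refine martingale_nat hadp (fun N => hI (N + 1)) fun N => ?_
    have e : W (N + 1) = W N * Y (N + 1) := Finset.prod_range_succ _ _
    have h1 := condExp_mul_of_stronglyMeasurable_left (hadp N) (e ▸ hI (N + 1 + 1)) (hint (N + 1))
    have h2 := hind.condExp_natural_ae_eq_of_lt (fun n => (hm n).stronglyMeasurable)
      (Nat.lt_succ_self N)
    rw [e]
    filter_upwards [h1, h2] with ω h1 h2
    rw [h1, Pi.mul_apply, h2, hintegral, mul_one]
  have hbdd : ∀ N, eLpNorm (W N) 1 P ≤ (1 : NNReal) := by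
    intro N
    have e : ∫ ω, W N ω ∂P = 1 := by
      have h := hmart.setIntegral_eq (Nat.zero_le N) MeasurableSet.univ
      simp only [Measure.restrict_univ] at h
      rw [← h]
      simpa [hW] using hintegral 0
    have hnn : 0 ≤ᵐ[P] W N := by
      filter_upwards [hpos'] with ω h
      simp only [hW, Finset.prod_apply, Pi.zero_apply]
      exact Finset.prod_nonneg fun n _ => (h n).le
    rw [eLpNorm_one_eq_lintegral_enorm]
    have : ∫⁻ ω, ‖W N ω‖ₑ ∂P = ENNReal.ofReal (∫ ω, W N ω ∂P) := by
      rw [ofReal_integral_eq_lintegral_ofReal (hI (N + 1)) hnn]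
      refine lintegral_congr_ae ?_
      filter_upwards [hnn] with ω h
      exact Real.enorm_of_nonneg h
    rw [this, e]
    simp
  have hlim : ∀ᵐ ω ∂P, ∃ z, Tendsto (fun N => ∏ n ∈ Finset.range N, Y n ω) atTop (𝓝 z) := by
    filter_upwards [hmart.submartingale.exists_ae_tendsto_of_bdd hbdd] with ω ⟨z, h⟩
    refine ⟨z, ?_⟩
    rw [← tendsto_add_atTop_iff_nat 1]
    simpa [hW, Finset.prod_apply] using h
  obtain ⟨Z, hZm, hZ⟩ := measurable_limit_of_tendsto_metrizable_ae (fun N => by fun_prop) hlim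
  exact ⟨Z, hZm.aemeasurable, hZ⟩

/-- Convergence of moments under almost sure convergence, if the moments of a slightly larger order
are bounded: this bound makes the `s`-th powers uniformly integrable. -/
lemma tendsto_lintegral_rpow_of_bounded {Ω : Type*} [MeasurableSpace Ω] {P : Measure Ω}
    [IsProbabilityMeasure P] {U : ℕ → Ω → ℝ} {Z : Ω → ℝ} (hU : ∀ N, AEMeasurable (U N) P)
    (hUpos : ∀ N, ∀ᵐ ω ∂P, 0 < U N ω) (hZpos : ∀ᵐ ω ∂P, 0 < Z ω)
    (hlim : ∀ᵐ ω ∂P, Tendsto (fun N => U N ω) atTop (𝓝 (Z ω)))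
    {s ε : ℝ} (hε : 0 < ε) {C : ENNReal} (hC : C ≠ ⊤)
    (hbd : ∀ N, ∫⁻ ω, ENNReal.ofReal (U N ω ^ (s * (1 + ε))) ∂P ≤ C) :
    Tendsto (fun N => ∫⁻ ω, ENNReal.ofReal (U N ω ^ s) ∂P) atTop
      (𝓝 (∫⁻ ω, ENNReal.ofReal (Z ω ^ s) ∂P)) := by
  have hlim' : ∀ᵐ ω ∂P, Tendsto (fun N => ENNReal.ofReal (U N ω ^ s)) atTop
      (𝓝 (ENNReal.ofReal (Z ω ^ s))) := by
    filter_upwards [hlim, hZpos] with ω h hz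
    exact ENNReal.tendsto_ofReal (h.rpow_const (Or.inl hz.ne'))
  refine tendsto_of_le_liminf_of_limsup_le ?_ ?_
  · calc _ = ∫⁻ ω, liminf (fun N => ENNReal.ofReal (U N ω ^ s)) atTop ∂P := by
          refine lintegral_congr_ae ?_
          filter_upwards [hlim'] with ω h using h.liminf_eq.symm
      _ ≤ _ := lintegral_liminf_le' fun N => by fun_prop
  · -- truncate at `K`, using `u ≤ min u K + K ^ (-ε) * u ^ (1 + ε)`
    have key : ∀ K : ℝ, 0 < K → limsup (fun N => ∫⁻ ω, ENNReal.ofReal (U N ω ^ s) ∂P) atTop ≤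
        ∫⁻ ω, ENNReal.ofReal (Z ω ^ s) ∂P + ENNReal.ofReal (K ^ (-ε)) * C := by
      intro K hK
      have ht : Tendsto (fun N => ∫⁻ ω, min (ENNReal.ofReal (U N ω ^ s)) (ENNReal.ofReal K) ∂P +
          ENNReal.ofReal (K ^ (-ε)) * C) atTop
          (𝓝 (∫⁻ ω, min (ENNReal.ofReal (Z ω ^ s)) (ENNReal.ofReal K) ∂P +
            ENNReal.ofReal (K ^ (-ε)) * C)) := by
        refine Tendsto.add ?_ tendsto_const_nhds
        refine tendsto_lintegral_of_dominated_convergence' (fun _ => ENNReal.ofReal K)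
          (fun N => by fun_prop) (fun N => ae_of_all _ fun ω => min_le_right _ _) (by simp) ?_
        filter_upwards [hlim'] with ω h using h.min tendsto_const_nhds
      calc _ ≤ limsup (fun N => ∫⁻ ω, min (ENNReal.ofReal (U N ω ^ s)) (ENNReal.ofReal K) ∂P +
          ENNReal.ofReal (K ^ (-ε)) * C) atTop := by
            refine limsup_le_limsup (Eventually.of_forall fun N => ?_)
            calc _ ≤ ∫⁻ ω, (min (ENNReal.ofReal (U N ω ^ s)) (ENNReal.ofReal K) +
                  ENNReal.ofReal (K ^ (-ε)) * ENNReal.ofReal (U N ω ^ (s * (1 + ε)))) ∂P := by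
                  refine lintegral_mono_ae ?_
                  filter_upwards [hUpos N] with ω hu
                  rcases le_total (U N ω ^ s) K with h | h
                  · rw [min_eq_left (ENNReal.ofReal_le_ofReal h)]
                    exact le_self_add
                  · refine le_trans ?_ le_add_self
                    rw [← ENNReal.ofReal_mul (by positivity)]
                    refine ENNReal.ofReal_le_ofReal ?_
                    have hus : 0 < U N ω ^ s := by positivity
                    rw [Real.rpow_mul hu.le, Real.rpow_add hus, Real.rpow_one,
                      Real.rpow_neg hK.le, ← div_eq_inv_mul, mul_div_assoc]
                    refine le_mul_of_one_le_right hus.le ?_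
                    rw [one_le_div (by positivity)]
                    exact Real.rpow_le_rpow hK.le h hε.le
              _ = ∫⁻ ω, min (ENNReal.ofReal (U N ω ^ s)) (ENNReal.ofReal K) ∂P +
                  ENNReal.ofReal (K ^ (-ε)) *
                    ∫⁻ ω, ENNReal.ofReal (U N ω ^ (s * (1 + ε))) ∂P := by
                  rw [lintegral_add_left' (by fun_prop),
                    lintegral_const_mul' _ _ ENNReal.ofReal_ne_top]
              _ ≤ _ := add_le_add le_rfl (mul_le_mul' le_rfl (hbd N))
        _ = _ := ht.limsup_eq
        _ ≤ _ := by
            exact add_le_add (lintegral_mono fun _ => min_le_left _ _) le_rfl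
    have hK : Tendsto (fun K : ℝ => ∫⁻ ω, ENNReal.ofReal (Z ω ^ s) ∂P +
        ENNReal.ofReal (K ^ (-ε)) * C) atTop
        (𝓝 (∫⁻ ω, ENNReal.ofReal (Z ω ^ s) ∂P + ENNReal.ofReal 0 * C)) :=
      tendsto_const_nhds.add (ENNReal.Tendsto.mul_const
        (ENNReal.tendsto_ofReal (tendsto_rpow_neg_atTop hε)) (Or.inr hC))
    rw [ENNReal.ofReal_zero, zero_mul, add_zero] at hK
    refine ge_of_tendsto hK ?_
    filter_upwards [eventually_gt_atTop 0] with K hK using key K hK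

/-- An almost sure limit of positive random variables is positive, if their moments of some
negative order are bounded. -/
lemma ae_pos_of_bounded_neg_moment {Ω : Type*} [MeasurableSpace Ω] {P : Measure Ω}
    {U : ℕ → Ω → ℝ} {Z : Ω → ℝ} (hU : ∀ N, AEMeasurable (U N) P)
    (hUpos : ∀ᵐ ω ∂P, ∀ N, 0 < U N ω) (hZ : AEMeasurable Z P)
    (hlim : ∀ᵐ ω ∂P, Tendsto (fun N => U N ω) atTop (𝓝 (Z ω)))
    {δ : ℝ} (hδ : 0 < δ) {C : ENNReal} (hC : C ≠ ⊤)
    (hbd : ∀ N, ∫⁻ ω, ENNReal.ofReal (U N ω ^ (-δ)) ∂P ≤ C) : ∀ᵐ ω ∂P, 0 < Z ω := by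
  -- the power is taken in `[0, ∞]`, where `0 ^ (-δ) = ∞`
  have hfin : ∫⁻ ω, ENNReal.ofReal (Z ω) ^ (-δ) ∂P ≤ C := by
    calc _ = ∫⁻ ω, liminf (fun N => ENNReal.ofReal (U N ω ^ (-δ))) atTop ∂P := by
          refine lintegral_congr_ae ?_
          filter_upwards [hlim, hUpos] with ω h hu
          simp_rw [← fun N => ENNReal.ofReal_rpow_of_pos (p := -δ) (hu N)]
          exact ((ENNReal.continuous_rpow_const.tendsto _).comp
            (ENNReal.tendsto_ofReal h)).liminf_eq.symm
      _ ≤ liminf (fun N => ∫⁻ ω, ENNReal.ofReal (U N ω ^ (-δ)) ∂P) atTop :=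
          lintegral_liminf_le' fun N => by fun_prop
      _ ≤ C := by
          refine le_trans (liminf_le_liminf (v := fun _ => C) (Eventually.of_forall hbd)) ?_
          simp
  have := ae_lt_top' (by fun_prop) (ne_top_of_le_ne_top hC hfin)
  filter_upwards [this] with ω h
  by_contra! hz
  rw [ENNReal.ofReal_of_nonpos hz, ENNReal.zero_rpow_of_neg (by linarith)] at h
  exact lt_irrefl _ h

/-- The moments of a product of independent positive random variables. -/
lemma lintegral_prod_rpow {Ω : Type*} [MeasurableSpace Ω]
    {P : Measure Ω} {Y : ℕ → Ω → ℝ} (hind : iIndepFun Y P)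
    (hm : ∀ n, Measurable (Y n)) (hpos : ∀ n, ∀ᵐ ω ∂P, 0 < Y n ω) (s : ℝ) (N : ℕ) :
    ∫⁻ ω, ENNReal.ofReal ((∏ n ∈ Finset.range N, Y n ω) ^ s) ∂P =
      ∏ n ∈ Finset.range N, ∫⁻ ω, ENNReal.ofReal (Y n ω ^ s) ∂P := by
  have h := hind.comp (fun _ x => ENNReal.ofReal (x ^ s)) (fun _ => by fun_prop)
  rw [← lintegral_prod_eq_prod_lintegral_of_indepFun _ (fun n ω => ENNReal.ofReal (Y n ω ^ s)) h
    (fun n => by have := hm n; fun_prop)]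
  refine lintegral_congr_ae ?_
  filter_upwards [ae_all_iff.2 hpos] with ω hω
  rw [← Real.finsetProd_rpow _ _ (fun n _ => (hω n).le),
    ENNReal.ofReal_prod_of_nonneg fun n _ => by have := hω n; positivity]

/-! ### Products of normalized Beta variables -/

lemma betaMeasure_pos (p q : ℝ) : ∀ᵐ x ∂betaMeasure p q, 0 < x := by
  rw [ae_iff, betaMeasure, withDensity_apply' _ _, lintegral_eq_zero_iff' ?_]
  · filter_upwards [ae_restrict_mem (by measurability)] with x hx
    exact betaPDF_eq_zero_of_nonpos (not_lt.1 hx)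
  · exact (measurable_betaPDFReal p q).ennreal_ofReal.aemeasurable

/-- The moments of the Beta law. -/
lemma rpowMoment_betaMeasure {p q s : ℝ} (hp : 0 < p) (hq : 0 < q) (hs : 0 < p + s) :
    rpowMoment (betaMeasure p q) s = ENNReal.ofReal
      (Real.Gamma (p + s) * Real.Gamma (p + q) / (Real.Gamma p * Real.Gamma (p + q + s))) := by
  have hB := beta_pos hp hq
  have hB' := beta_pos hs hq
  have hm : Measurable (betaPDF (p + s) q) :=
    (measurable_betaPDFReal (p + s) q).ennreal_ofReal
  rw [rpowMoment, betaMeasure, lintegral_withDensity_eq_lintegral_mul _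
    (show Measurable (betaPDF p q) from (measurable_betaPDFReal p q).ennreal_ofReal)
    (by fun_prop)]
  have e : ∀ x, (betaPDF p q * fun x => ENNReal.ofReal (x ^ s)) x =
      ENNReal.ofReal (beta (p + s) q / beta p q) * betaPDF (p + s) q x := by
    intro x
    simp only [Pi.mul_apply]
    by_cases hx : 0 < x ∧ x < 1
    · have h1 : 0 < 1 - x := by linarith [hx.2]
      have h0 := hx.1
      rw [betaPDF_of_pos_lt_one hx.1 hx.2, betaPDF_of_pos_lt_one hx.1 hx.2,
        ← ENNReal.ofReal_mul (by positivity), ← ENNReal.ofReal_mul (by positivity),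
        show p + s - 1 = (p - 1) + s by ring, Real.rpow_add h0]
      congr 1
      field_simp
    · rw [betaPDF_eq, betaPDF_eq, if_neg hx, if_neg hx]
      simp
  simp_rw [e]
  rw [lintegral_const_mul _ hm, lintegral_betaPDF_eq_one hs hq, mul_one]
  congr 1
  have h1 := Real.Gamma_pos_of_pos hq
  have h2 := Real.Gamma_pos_of_pos hp
  have h3 := Real.Gamma_pos_of_pos hs
  have h4 := Real.Gamma_pos_of_pos (add_pos hp hq)
  have h5 := Real.Gamma_pos_of_pos (add_pos hs hq)
  rw [beta, beta, show p + s + q = p + q + s by ring] at *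
  field_simp

/-- The moment of order `s` of `((p + q) / p) * B`, where `B` has the Beta law with parameters `p`
and `q`. -/
noncomputable def betaFactor (p q s : ℝ) : ℝ :=
  ((p + q) / p) ^ s *
    (Real.Gamma (p + s) * Real.Gamma (p + q) / (Real.Gamma p * Real.Gamma (p + q + s)))

lemma betaFactor_pos {p q s : ℝ} (hp : 0 < p) (hq : 0 < q) (hs : 0 < p + s) :
    0 < betaFactor p q s := by
  have h2 := Real.Gamma_pos_of_pos hp
  have h3 := Real.Gamma_pos_of_pos hs
  have h4 := Real.Gamma_pos_of_pos (add_pos hp hq)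
  have h5 := Real.Gamma_pos_of_pos (show 0 < p + q + s by linarith)
  unfold betaFactor
  positivity

lemma betaFactor_add_one {p q s : ℝ} (hp : 0 < p) (hq : 0 < q) (hs : 0 < p + s) :
    betaFactor p q (s + 1) =
      (p + q) / p * ((p + s) / (p + q + s)) * betaFactor p q s := by
  have h5 := Real.Gamma_pos_of_pos (show 0 < p + q + s by linarith)
  have h6 : 0 < p + q + s := by linarith
  have h7 := Real.Gamma_pos_of_pos hp
  unfold betaFactor
  rw [Real.rpow_add_one (by positivity), ← add_assoc, ← add_assoc, Real.Gamma_add_one hs.ne',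
    Real.Gamma_add_one h6.ne']
  field_simp

lemma betaFactor_one {p q : ℝ} (hp : 0 < p) (hq : 0 < q) : betaFactor p q 1 = 1 := by
  have h := betaFactor_add_one (s := 0) hp hq (by linarith)
  have h4 := Real.Gamma_pos_of_pos (add_pos hp hq)
  have h7 := Real.Gamma_pos_of_pos hp
  rw [zero_add] at h
  rw [h]
  unfold betaFactor
  simp only [Real.rpow_zero, add_zero]
  field_simp

/-- The moment of order `s` of the `N`-th partial product of the variables
`((p + d n + q) / (p + d n)) * B n`, where `B n` has the Beta law with parameters `p + d n`
and `q`. -/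
noncomputable def betaProd (p d q s : ℝ) (N : ℕ) : ℝ :=
  ∏ n ∈ Finset.range N, betaFactor (p + d * n) q s

lemma betaProd_pos {p d q s : ℝ} (hp : 0 < p) (hd : 0 < d) (hq : 0 < q) (hs : 0 < p + s) (N : ℕ) :
    0 < betaProd p d q s N :=
  Finset.prod_pos fun n _ => betaFactor_pos (by positivity) hq (by
    have : 0 ≤ d * (n : ℝ) := by positivity
    linarith)

/-- The quotient `betaProd (s + 1) / betaProd s` converges, since it telescopes to a quotient of
Gamma values. -/
lemma tendsto_betaProd_add_one_div {p d q s : ℝ} (hp : 0 < p) (hd : 0 < d) (hq : 0 < q)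
    (hs : 0 < p + s) :
    Tendsto (fun N => betaProd p d q (s + 1) N / betaProd p d q s N) atTop
      (𝓝 (Real.Gamma (p / d) / Real.Gamma ((p + q) / d) *
        (Real.Gamma ((p + q + s) / d) / Real.Gamma ((p + s) / d)))) := by
  have hpqs : 0 < p + q + s := by linarith
  have e : ∀ N, betaProd p d q (s + 1) N / betaProd p d q s N =
      Real.Gamma (p / d) / Real.Gamma ((p + q) / d) *
        (Real.Gamma ((p + q + s) / d) / Real.Gamma ((p + s) / d)) *
      ((Real.Gamma (N + (p + q) / d) / Real.Gamma (N + p / d)) *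
        (Real.Gamma (N + (p + s) / d) / Real.Gamma (N + (p + q + s) / d))) := by
    intro N
    have h1 := prod_range_add_div_add (x := (p + q) / d) (y := p / d) (by positivity)
      (by positivity) N
    have h2 := prod_range_add_div_add (x := (p + s) / d) (y := (p + q + s) / d) (by positivity)
      (by positivity) N
    have h3 : betaProd p d q (s + 1) N = (∏ k ∈ Finset.range N, ((p + q) / d + k) / (p / d + k)) *
        (∏ k ∈ Finset.range N, ((p + s) / d + k) / ((p + q + s) / d + k)) *
        betaProd p d q s N := by
      rw [betaProd, betaProd, ← Finset.prod_mul_distrib, ← Finset.prod_mul_distrib]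
      refine Finset.prod_congr rfl fun k _ => ?_
      have hk : 0 ≤ d * (k : ℝ) := by positivity
      rw [betaFactor_add_one (by positivity) hq (by linarith)]
      have h5 : 0 < p + q + s + d * k := by linarith
      have h6 : (p + d * k + q + s) ≠ 0 := by linarith
      congr 1
      field_simp
      ring
    rw [h3, h1, h2, mul_div_assoc, div_self (betaProd_pos hp hd hq hs N).ne']
    ring
  simp_rw [e]
  have h1 := (tendsto_Gamma_add_div_Gamma_add ((p + q) / d) (p / d)).mul
    (tendsto_Gamma_add_div_Gamma_add ((p + s) / d) ((p + q + s) / d))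
  have h2 := (h1.comp tendsto_natCast_atTop_atTop).const_mul
    (Real.Gamma (p / d) / Real.Gamma ((p + q) / d) *
        (Real.Gamma ((p + q + s) / d) / Real.Gamma ((p + s) / d)))
  rw [mul_one, mul_one] at h2
  refine h2.congr' ?_
  filter_upwards [eventually_gt_atTop 0] with N hN
  have hN' : (0 : ℝ) < N := by exact_mod_cast hN
  simp only [Function.comp]
  have h3 : (N : ℝ) ^ (p / d - (p + q) / d) * (N : ℝ) ^ ((p + q + s) / d - (p + s) / d) = 1 := by
    rw [← Real.rpow_add hN', ← Real.rpow_zero (N : ℝ)]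
    congr 1
    field_simp
    ring
  linear_combination (Real.Gamma (p / d) / Real.Gamma ((p + q) / d) *
        (Real.Gamma ((p + q + s) / d) / Real.Gamma ((p + s) / d)) *
      ((Real.Gamma (N + (p + q) / d) / Real.Gamma (N + p / d)) *
        (Real.Gamma (N + (p + s) / d) / Real.Gamma (N + (p + q + s) / d)))) * h3

/-- The quotient `betaProd (s + d) / betaProd s` converges: the Gamma values that depend on `s`
telescope. -/
lemma tendsto_betaProd_add_div {p d q s : ℝ} (hp : 0 < p) (hd : 0 < d) (hq : 0 < q)
    (hs : 0 < p + s) :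
    Tendsto (fun N => betaProd p d q (s + d) N / betaProd p d q s N) atTop
      (𝓝 ((d ^ (q / d) * (Real.Gamma ((p + q) / d) / Real.Gamma (p / d))) ^ (-d) *
        (Real.Gamma (p + q + s) / Real.Gamma (p + s)))) := by
  have hpqs : 0 < p + q + s := by linarith
  have hG1 := Real.Gamma_pos_of_pos (show 0 < p / d by positivity)
  have hG2 := Real.Gamma_pos_of_pos (show 0 < (p + q) / d by positivity)
  have hG3 := Real.Gamma_pos_of_pos hpqs
  have hG4 := Real.Gamma_pos_of_pos hs
  have e : ∀ N, betaProd p d q (s + d) N / betaProd p d q s N =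
      (∏ k ∈ Finset.range N, ((p + q) / d + k) / (p / d + k)) ^ d *
        (Real.Gamma (p + q + s) / Real.Gamma (p + s) *
          (Real.Gamma (d * N + (p + s)) / Real.Gamma (d * N + (p + q + s)))) := by
    intro N
    rw [div_eq_iff (betaProd_pos hp hd hq hs N).ne']
    unfold betaProd
    induction N with
    | zero => simp; field_simp
    | succ N ih =>
      have hk : 0 ≤ d * (N : ℝ) := by positivity
      rw [Finset.prod_range_succ, Finset.prod_range_succ, Finset.prod_range_succ, ih,
        Real.mul_rpow (Finset.prod_nonneg fun k _ => by positivity) (by positivity)]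
      unfold betaFactor
      have g1 := Real.Gamma_pos_of_pos (show 0 < d * N + (p + s) by linarith)
      have g2 := Real.Gamma_pos_of_pos (show 0 < d * N + (p + q + s) by linarith)
      have g3 := Real.Gamma_pos_of_pos (show 0 < d * N + (p + q + s) + d by linarith)
      have g4 := Real.Gamma_pos_of_pos (show 0 < p + d * N by linarith)
      have g5 : 0 < (p + d * N + q) / (p + d * N) := by positivity
      push_cast
      rw [show p + d * N + (s + d) = d * (N + 1) + (p + s) by ring,
        show p + d * N + q + (s + d) = d * N + (p + q + s) + d by ring,
        show d * (N + 1) + (p + q + s) = d * N + (p + q + s) + d by ring,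
        show p + d * N + s = d * N + (p + s) by ring,
        show p + d * N + q + s = d * N + (p + q + s) by ring,
        show ((p + q) / d + N) / (p / d + N) = (p + d * N + q) / (p + d * N) by
          field_simp; ring,
        Real.rpow_add g5]
      field_simp
  simp_rw [e]
  have hl1 : Tendsto (fun N : ℕ => (Real.Gamma (p / d) / Real.Gamma ((p + q) / d) *
      (Real.Gamma (N + (p + q) / d) / Real.Gamma (N + p / d) * (N : ℝ) ^ (p / d - (p + q) / d)))
        ^ d) atTop (𝓝 ((Real.Gamma (p / d) / Real.Gamma ((p + q) / d) * 1) ^ d)) :=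
    (((tendsto_Gamma_add_div_Gamma_add ((p + q) / d) (p / d)).comp
      tendsto_natCast_atTop_atTop).const_mul _).rpow_const (Or.inr hd.le)
  have hl2 : Tendsto (fun N : ℕ => Real.Gamma (d * N + (p + s)) /
      Real.Gamma (d * N + (p + q + s)) * (d * N : ℝ) ^ (p + q + s - (p + s))) atTop (𝓝 1) :=
    (tendsto_Gamma_add_div_Gamma_add (p + s) (p + q + s)).comp
      (tendsto_natCast_atTop_atTop.const_mul_atTop hd)
  have hl := (hl1.mul hl2).const_mul (d ^ (-q) * (Real.Gamma (p + q + s) / Real.Gamma (p + s)))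
  have hc : d ^ (-q) * (Real.Gamma (p + q + s) / Real.Gamma (p + s)) *
      ((Real.Gamma (p / d) / Real.Gamma ((p + q) / d) * 1) ^ d * 1) =
      (d ^ (q / d) * (Real.Gamma ((p + q) / d) / Real.Gamma (p / d))) ^ (-d) *
        (Real.Gamma (p + q + s) / Real.Gamma (p + s)) := by
    rw [mul_one, mul_one, Real.mul_rpow (x := d ^ (q / d)) (by positivity) (by positivity),
      ← Real.rpow_mul hd.le, Real.rpow_neg (x := _ / _) (by positivity),
      ← Real.inv_rpow (by positivity), inv_div,
      show q / d * -d = -q by field_simp]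
    ring
  rw [hc] at hl
  refine hl.congr' ?_
  filter_upwards [eventually_gt_atTop 0] with N hN
  have hN' : (0 : ℝ) < N := by exact_mod_cast hN
  have g1 := Real.Gamma_pos_of_pos (show 0 < N + (p + q) / d by positivity)
  have g2 := Real.Gamma_pos_of_pos (show 0 < N + p / d by positivity)
  rw [prod_range_add_div_add (by positivity) (by positivity),
    ← mul_assoc (Real.Gamma (p / d) / Real.Gamma ((p + q) / d)),
    Real.mul_rpow (z := d) (by positivity) (by positivity), ← Real.rpow_mul hN'.le,
    Real.mul_rpow hd.le hN'.le, show p + q + s - (p + s) = q by ring,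
    show (p / d - (p + q) / d) * d = -q by field_simp; ring, Real.rpow_neg hd.le,
    Real.rpow_neg hN'.le]
  field_simp

/-- For fixed `s > -p`, the moments of order `s` of the partial products are bounded. By the
recursion in `s`, boundedness at `s = 0` propagates to all natural numbers, from there to all
`s ≥ 0`, and back to all `s > -p`. -/
lemma exists_betaProd_le_of_moments {p d q : ℝ} (hp : 0 < p) (hd : 0 < d) (hq : 0 < q)
    (hmono : ∀ (s : ℝ) (k N : ℕ), 0 ≤ s → s ≤ k → betaProd p d q s N ≤ 1 + betaProd p d q k N)
    {s : ℝ} (hs : 0 < p + s) : ∃ C, ∀ N, betaProd p d q s N ≤ C := by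
  have hup : ∀ s, 0 < p + s → (∃ C, ∀ N, betaProd p d q s N ≤ C) →
      ∃ C, ∀ N, betaProd p d q (s + 1) N ≤ C := by
    rintro s hs ⟨C, hC⟩
    obtain ⟨R, hR⟩ := (tendsto_betaProd_add_one_div hp hd hq hs).bddAbove_range
    refine ⟨R * C, fun N => ?_⟩
    have h := hR ⟨N, rfl⟩
    have h0 := betaProd_pos hp hd hq hs N
    have h1 := betaProd_pos hp hd hq (s := s + 1) (by linarith) N
    simp only at h
    have hR0 : 0 ≤ R := (div_pos h1 h0).le.trans h
    calc betaProd p d q (s + 1) N =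
        betaProd p d q (s + 1) N / betaProd p d q s N * betaProd p d q s N := by field_simp
      _ ≤ R * C := mul_le_mul h (hC N) h0.le hR0
  have hdown : ∀ s, 0 < p + s → (∃ C, ∀ N, betaProd p d q (s + 1) N ≤ C) →
      ∃ C, ∀ N, betaProd p d q s N ≤ C := by
    rintro s hs ⟨C, hC⟩
    have hl := tendsto_betaProd_add_one_div hp hd hq hs
    have hpos : 0 < Real.Gamma (p / d) / Real.Gamma ((p + q) / d) *
        (Real.Gamma ((p + q + s) / d) / Real.Gamma ((p + s) / d)) := by
      have g1 := Real.Gamma_pos_of_pos (show 0 < p / d by positivity)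
      have g2 := Real.Gamma_pos_of_pos (show 0 < (p + q) / d by positivity)
      have g3 := Real.Gamma_pos_of_pos (show 0 < (p + q + s) / d by
        have : 0 < p + q + s := by linarith
        positivity)
      have g4 := Real.Gamma_pos_of_pos (show 0 < (p + s) / d by positivity)
      positivity
    obtain ⟨R, hR⟩ := (hl.inv₀ hpos.ne').bddAbove_range
    refine ⟨R * C, fun N => ?_⟩
    have h := hR ⟨N, rfl⟩
    have h0 := betaProd_pos hp hd hq hs N
    have h1 := betaProd_pos hp hd hq (s := s + 1) (by linarith) N
    simp only [inv_div] at h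
    have hR0 : 0 ≤ R := (div_pos h0 h1).le.trans h
    calc betaProd p d q s N =
        betaProd p d q s N / betaProd p d q (s + 1) N * betaProd p d q (s + 1) N := by field_simp
      _ ≤ R * C := mul_le_mul h (hC N) h1.le hR0
  have hnat : ∀ k : ℕ, ∃ C, ∀ N, betaProd p d q k N ≤ C := by
    intro k
    induction k with
    | zero =>
      refine ⟨1, fun N => le_of_eq ?_⟩
      refine Finset.prod_eq_one fun n _ => ?_
      have h4 := Real.Gamma_pos_of_pos (show 0 < p + d * n + q by positivity)
      have h7 := Real.Gamma_pos_of_pos (show 0 < p + d * n by positivity)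
      simp only [betaFactor, Nat.cast_zero, Real.rpow_zero, add_zero]
      field_simp
    | succ k ih => exact_mod_cast hup k (by positivity) ih
  have hnonneg : ∀ s, 0 ≤ s → ∃ C, ∀ N, betaProd p d q s N ≤ C := by
    intro s hs
    obtain ⟨k, hk⟩ := exists_nat_ge s
    obtain ⟨C, hC⟩ := hnat k
    exact ⟨1 + C, fun N => (hmono s k N hs hk).trans (by linarith [hC N])⟩
  have hdesc : ∀ k : ℕ, ∀ s, 0 < p + s → 0 ≤ s + k → ∃ C, ∀ N, betaProd p d q s N ≤ C := by
    intro k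
    induction k with
    | zero => intro s _ h; exact hnonneg s (by simpa using h)
    | succ k ih =>
      intro s hs h
      refine hdown s hs (ih (s + 1) (by linarith) ?_)
      push_cast at h
      linarith
  obtain ⟨k, hk⟩ := exists_nat_ge (-s)
  exact hdesc k s hs (by linarith)

/-- The infinite product of the variables `((p + d n + q) / (p + d n)) * B n` converges almost
surely to a positive limit, and its moments of order `s > -p` are the limits of the moments of the
partial products. -/
lemma IsIndepBetaSeq.exists_infiniteProduct {Ω : Type*} [MeasurableSpace Ω] {P : Measure Ω}
    [IsProbabilityMeasure P] {p d q : ℝ} (hp : 0 < p) (hd : 0 < d) (hq : 0 < q) {B : ℕ → Ω → ℝ}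
    (hB : IsIndepBetaSeq (fun n => p + d * n) (fun _ => q) B P) :
    ∃ Z : Ω → ℝ, AEMeasurable Z P ∧
      IsASInfiniteProduct (fun n ω => (p + d * n + q) / (p + d * n) * B n ω) Z P ∧
      ∀ s, 0 < p + s → Tendsto (fun N => ENNReal.ofReal (betaProd p d q s N)) atTop
        (𝓝 (∫⁻ ω, ENNReal.ofReal (Z ω ^ s) ∂P)) := by
  have hcpos : ∀ n : ℕ, 0 < (p + d * n + q) / (p + d * n) := fun n => by positivity
  have hpn : ∀ n : ℕ, 0 < p + d * n := fun n => by positivity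
  have hBm : ∀ n, AEMeasurable (B n) P := fun n => (hB.hasLaw n).aemeasurable
  -- measurable versions of the factors
  set Y : ℕ → Ω → ℝ := fun n ω => (p + d * n + q) / (p + d * n) * (hBm n).mk (B n) ω with hY
  have hYm : ∀ n, Measurable (Y n) := fun n => (hBm n).measurable_mk.const_mul _
  have hYB : ∀ n, Y n =ᵐ[P] fun ω => (p + d * n + q) / (p + d * n) * B n ω := fun n => by
    filter_upwards [(hBm n).ae_eq_mk] with ω h
    simp only [hY]
    rw [h]
  have hind : iIndepFun Y P :=
    (hB.indep.congr fun n => (hBm n).ae_eq_mk).comp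
      (fun n x => (p + d * n + q) / (p + d * n) * x) (fun n => by fun_prop)
  have hBpos : ∀ n, ∀ᵐ ω ∂P, 0 < B n ω := fun n =>
    ((hB.hasLaw n).ae_iff (p := fun x => 0 < x) (by fun_prop)).2 (betaMeasure_pos _ _)
  have hpos : ∀ n, ∀ᵐ ω ∂P, 0 < Y n ω := fun n => by
    filter_upwards [hYB n, hBpos n] with ω h1 h2
    rw [h1]
    exact mul_pos (hcpos n) h2
  have hmom : ∀ n s, 0 < p + s →
      ∫⁻ ω, ENNReal.ofReal (Y n ω ^ s) ∂P = ENNReal.ofReal (betaFactor (p + d * n) q s) := by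
    intro n s hs
    have hs' : 0 < p + d * n + s := by
      have : 0 ≤ d * (n : ℝ) := by positivity
      linarith
    have h1 : ∫⁻ ω, ENNReal.ofReal (B n ω ^ s) ∂P = rpowMoment (betaMeasure (p + d * n) q) s := by
      rw [rpowMoment, ← (hB.hasLaw n).map_eq, lintegral_map' (by fun_prop) (hBm n)]
    rw [betaFactor, ENNReal.ofReal_mul (Real.rpow_nonneg (hcpos n).le _),
      ← rpowMoment_betaMeasure (hpn n) hq hs', ← h1,
      ← lintegral_const_mul' _ _ ENNReal.ofReal_ne_top]
    refine lintegral_congr_ae ?_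
    filter_upwards [hYB n, hBpos n] with ω h1 h2
    rw [h1, Real.mul_rpow (hcpos n).le h2.le,
      ENNReal.ofReal_mul (Real.rpow_nonneg (hcpos n).le _)]
  have hprod : ∀ s, 0 < p + s → ∀ N,
      ∫⁻ ω, ENNReal.ofReal ((∏ n ∈ Finset.range N, Y n ω) ^ s) ∂P =
        ENNReal.ofReal (betaProd p d q s N) := by
    intro s hs N
    rw [lintegral_prod_rpow hind hYm hpos, betaProd, ENNReal.ofReal_prod_of_nonneg]
    · exact Finset.prod_congr rfl fun n _ => hmom n s hs
    · intro n _
      refine (betaFactor_pos (hpn n) hq ?_).le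
      have : 0 ≤ d * (n : ℝ) := by positivity
      linarith
  have hpos' : ∀ᵐ ω ∂P, ∀ n, 0 < Y n ω := ae_all_iff.2 hpos
  have hUpos : ∀ᵐ ω ∂P, ∀ N, 0 < ∏ n ∈ Finset.range N, Y n ω := by
    filter_upwards [hpos'] with ω h N using Finset.prod_pos fun n _ => h n
  have hbdd : ∀ s, 0 < p + s → ∃ C, ∀ N, betaProd p d q s N ≤ C := by
    intro s hs
    refine exists_betaProd_le_of_moments hp hd hq (fun s k N h0 hk => ?_) hs
    have hk0 := betaProd_pos hp hd hq (s := (k : ℝ)) (by positivity) N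
    rw [← ENNReal.ofReal_le_ofReal_iff (by positivity), ENNReal.ofReal_add zero_le_one hk0.le,
      ← hprod s (by linarith), ← hprod k (by positivity)]
    calc _ ≤ ∫⁻ ω, (ENNReal.ofReal 1 +
          ENNReal.ofReal ((∏ n ∈ Finset.range N, Y n ω) ^ (k : ℝ))) ∂P := by
          refine lintegral_mono_ae ?_
          filter_upwards [hUpos] with ω h
          have hu := h N
          rw [← ENNReal.ofReal_add zero_le_one (by positivity)]
          refine ENNReal.ofReal_le_ofReal ?_
          rcases le_total (∏ n ∈ Finset.range N, Y n ω) 1 with h1 | h1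
          · exact (Real.rpow_le_one hu.le h1 h0).trans
              (le_add_of_nonneg_right (by positivity))
          · exact (Real.rpow_le_rpow_of_exponent_le h1 hk).trans
              (le_add_of_nonneg_left zero_le_one)
      _ = _ := by
          rw [lintegral_add_left (by fun_prop)]
          simp
  have hUm : ∀ N, AEMeasurable (fun ω => ∏ n ∈ Finset.range N, Y n ω) P := fun N => by fun_prop
  obtain ⟨Z, hZm, hZ⟩ := hind.exists_tendsto_prod hYm hpos fun n => by
    have h := hmom n 1 (by linarith)
    simpa only [Real.rpow_one, betaFactor_one (hpn n) hq, ENNReal.ofReal_one] using h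
  have hZpos : ∀ᵐ ω ∂P, 0 < Z ω := by
    obtain ⟨C, hC⟩ := hbdd (-(p / 2)) (by linarith)
    refine ae_pos_of_bounded_neg_moment hUm hUpos hZm hZ (half_pos hp)
      (C := ENNReal.ofReal C) ENNReal.ofReal_ne_top fun N => ?_
    rw [hprod _ (by linarith)]
    exact ENNReal.ofReal_le_ofReal (hC N)
  refine ⟨Z, hZm, ?_, fun s hs => ?_⟩
  · filter_upwards [hZ, hZpos, ae_all_iff.2 hYB] with ω h1 h2 h3
    refine ⟨h2, ?_⟩
    simpa only [h3] using h1
  · -- any `ε > 0` with `s * (1 + ε) > -p` will do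
    set ε := (p + s) / (2 * (1 + |s|)) with hε
    have hε0 : 0 < ε := by positivity
    have hsε : 0 < p + s * (1 + ε) := by
      have h1 : |s| * ε ≤ (p + s) / 2 := by
        rw [hε, ← mul_div_assoc, div_le_div_iff₀ (by positivity) two_pos]
        nlinarith [abs_nonneg s]
      have h2 : -(|s| * ε) ≤ s * ε := by
        rw [← neg_mul]; exact mul_le_mul_of_nonneg_right (neg_abs_le s) hε0.le
      linarith
    obtain ⟨C, hC⟩ := hbdd _ hsε
    have h := tendsto_lintegral_rpow_of_bounded hUm (fun N => hUpos.mono fun _ h => h N) hZpos hZ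
      (s := s) hε0 (C := ENNReal.ofReal C) ENNReal.ofReal_ne_top fun N => by
        rw [hprod _ hsε]
        exact ENNReal.ofReal_le_ofReal (hC N)
    simpa only [hprod s hs] using h

/-- If the quotients `betaProd (s + c) / betaProd s` converge to `R`, then the moments of the
infinite product satisfy the limiting recursion. -/
lemma lintegral_rpow_add_of_tendsto {Ω : Type*} [MeasurableSpace Ω] {P : Measure Ω}
    {p d q s c R : ℝ} (hp : 0 < p) (hd : 0 < d) (hq : 0 < q) (hs : 0 < p + s) (hc : 0 < c)
    {Z : Ω → ℝ} (hZ : ∀ s, 0 < p + s → Tendsto (fun N => ENNReal.ofReal (betaProd p d q s N)) atTop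
        (𝓝 (∫⁻ ω, ENNReal.ofReal (Z ω ^ s) ∂P)))
    (hR0 : 0 < R)
    (hR : Tendsto (fun N => betaProd p d q (s + c) N / betaProd p d q s N) atTop (𝓝 R)) :
    ∫⁻ ω, ENNReal.ofReal (Z ω ^ (s + c)) ∂P =
      ENNReal.ofReal R * ∫⁻ ω, ENNReal.ofReal (Z ω ^ s) ∂P := by
  have h1 := ENNReal.Tendsto.mul (ENNReal.tendsto_ofReal hR) (Or.inl (by simpa using hR0))
    (hZ s hs) (Or.inr ENNReal.ofReal_ne_top)
  refine tendsto_nhds_unique (hZ (s + c) (by linarith)) (h1.congr fun N => ?_)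
  have h0 := betaProd_pos hp hd hq hs N
  have h2 := betaProd_pos hp hd hq (s := s + c) (by linarith) N
  rw [← ENNReal.ofReal_mul (by positivity), div_mul_cancel₀ _ h0.ne']

/-- The moment recursion for `X = (c Z) ^ (-κ)`, in terms of the moments of `Z`. -/
lemma momentRecursion_map_rpow {Ω : Type*} [MeasurableSpace Ω] {P : Measure Ω}
    {α a c κ : ℝ} (hα : 0 < α) (hc : 0 < c) (hκ : 0 < κ) {Z : Ω → ℝ}
    (hZm : AEMeasurable Z P) (hZ : ∀ᵐ ω ∂P, 0 < Z ω)
    (h : ∀ s, 0 < κ * a + s → ∫⁻ ω, ENNReal.ofReal (Z ω ^ (s + κ * a)) ∂P =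
      ENNReal.ofReal (c ^ (-(κ * a)) * (Real.Gamma (s / κ + a + α) / Real.Gamma (s / κ + a))) *
        ∫⁻ ω, ENNReal.ofReal (Z ω ^ s) ∂P) :
    MomentRecursion α a (P.map fun ω => (c * Z ω) ^ (-κ)) := by
  have hmom : ∀ r, rpowMoment (P.map fun ω => (c * Z ω) ^ (-κ)) r =
      ENNReal.ofReal (c ^ (-κ * r)) * ∫⁻ ω, ENNReal.ofReal (Z ω ^ (-κ * r)) ∂P := by
    intro r
    rw [rpowMoment, lintegral_map' (by fun_prop) (by fun_prop),
      ← lintegral_const_mul' _ _ ENNReal.ofReal_ne_top]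
    refine lintegral_congr_ae ?_
    filter_upwards [hZ] with ω hz
    rw [← Real.rpow_mul (by positivity), Real.mul_rpow hc.le hz.le,
      ENNReal.ofReal_mul (by positivity)]
  intro t ht
  have hG := Real.Gamma_pos_of_pos ht
  have hG' := Real.Gamma_pos_of_pos (add_pos ht hα)
  have hs := h (-κ * (a - t)) (by have := mul_pos hκ ht; linarith)
  rw [show -κ * (a - t) + κ * a = -κ * -t by ring,
    show -κ * (a - t) / κ + a = t by field_simp; ring] at hs
  rw [hmom, hmom, hs, ← mul_assoc, ← mul_assoc, ← ENNReal.ofReal_mul (by positivity),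
    ← ENNReal.ofReal_mul (by positivity)]
  congr 2
  rw [show -κ * (a - t) = -κ * -t + -(κ * a) by ring, Real.rpow_add hc]
  field_simp

/-- The first product representation satisfies the moment recursion. -/
lemma IsIndepBetaSeq.exists_momentRecursion_inv {Ω : Type*} [MeasurableSpace Ω] {P : Measure Ω}
    [IsProbabilityMeasure P] {m α a : ℝ} (hα : 0 < α) (ha : 0 < a) (hm : m = a + α)
    {B : ℕ → Ω → ℝ} (hB : IsIndepBetaSeq (fun n => a + a * n) (fun _ => m - a) B P) :
    ∃ Z : Ω → ℝ, AEMeasurable Z P ∧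
      IsASInfiniteProduct (fun n ω => (m + a * n) / (a + a * n) * B n ω) Z P ∧
      MomentRecursion α a
        (P.map fun ω => (a ^ ((m - a) / a) * Real.Gamma (m / a) * Z ω) ^ (-1 : ℝ)) := by
  obtain ⟨Z, hZm, hZ, hmom⟩ := hB.exists_infiniteProduct ha ha (by linarith)
  refine ⟨Z, hZm, ?_, ?_⟩
  · simpa only [show ∀ n : ℕ, a + a * n + (m - a) = m + a * n from fun n => by ring] using hZ
  · have hG := Real.Gamma_pos_of_pos (show 0 < m / a by subst hm; positivity)
    refine momentRecursion_map_rpow hα (by positivity) one_pos hZm (hZ.mono fun _ h => h.1)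
      fun s hs => ?_
    rw [one_mul] at hs ⊢
    have hlim := tendsto_betaProd_add_div ha ha (show 0 < m - a by linarith) hs
    have g1 := Real.Gamma_pos_of_pos hs
    have g2 := Real.Gamma_pos_of_pos (show 0 < a + (m - a) + s by linarith)
    rw [lintegral_rpow_add_of_tendsto ha ha (by linarith) hs ha hmom ?_ hlim]
    · rw [div_self ha.ne', Real.Gamma_one, div_one, add_sub_cancel, div_one]
      subst hm
      ring_nf
    · have := Real.Gamma_pos_of_pos
        (show 0 < (a + (m - a)) / a by rw [add_sub_cancel, hm]; positivity)
      have := Real.Gamma_pos_of_pos (show 0 < a / a by positivity)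
      positivity

/-- The second product representation satisfies the moment recursion. -/
lemma IsIndepBetaSeq.exists_momentRecursion_rpow {Ω : Type*} [MeasurableSpace Ω] {P : Measure Ω}
    [IsProbabilityMeasure P] {m α a : ℝ} (hα : 0 < α) (ha : 0 < a) (hm : m = a + α)
    {B : ℕ → Ω → ℝ} (hB : IsIndepBetaSeq (fun n => 1 + n / a) (fun _ => m / a - 1) B P) :
    ∃ Z : Ω → ℝ, AEMeasurable Z P ∧
      IsASInfiniteProduct (fun n ω => (m + n) / (a + n) * B n ω) Z P ∧
      MomentRecursion α a
        (P.map fun ω => (Real.Gamma m / Real.Gamma a * Z ω) ^ (-(1 / a))) := by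
  have hq : 0 < m / a - 1 := by
    rw [hm, add_div, div_self ha.ne', add_sub_cancel_left]; positivity
  have hd : 0 < 1 / a := by positivity
  have hB' : IsIndepBetaSeq (fun n => 1 + 1 / a * n) (fun _ => m / a - 1) B P := by
    simpa only [one_div_mul_eq_div] using hB
  obtain ⟨Z, hZm, hZ, hmom⟩ := hB'.exists_infiniteProduct one_pos hd hq
  refine ⟨Z, hZm, ?_, ?_⟩
  · have e : ∀ n : ℕ, (1 + 1 / a * n + (m / a - 1)) / (1 + 1 / a * n) = (m + n) / (a + n) := by
      intro n
      field_simp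
      ring
    simpa only [e] using hZ
  · have hGm := Real.Gamma_pos_of_pos (show 0 < m by linarith)
    have hGa := Real.Gamma_pos_of_pos ha
    refine momentRecursion_map_rpow hα (by positivity) hd hZm (hZ.mono fun _ h => h.1)
      fun s hs => ?_
    have ha1 : 1 / a * a = 1 := by field_simp
    rw [ha1] at hs ⊢
    have hlim := tendsto_betaProd_add_one_div one_pos hd hq hs
    have e1 : (1 : ℝ) / (1 / a) = a := by field_simp
    have e2 : (1 + (m / a - 1)) / (1 / a) = m := by field_simp; ring
    have e3 : (1 + (m / a - 1) + s) / (1 / a) = s / (1 / a) + a + α := by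
      rw [hm]; field_simp; ring
    have e4 : (1 + s) / (1 / a) = s / (1 / a) + a := by field_simp; ring
    rw [e1, e2, e3, e4] at hlim
    have hsa : 0 < s / (1 / a) + a := by rw [← e4]; positivity
    have g1 := Real.Gamma_pos_of_pos hsa
    have g2 := Real.Gamma_pos_of_pos (add_pos hsa hα)
    rw [lintegral_rpow_add_of_tendsto one_pos hd hq hs one_pos hmom (by positivity) hlim,
      Real.rpow_neg_one, inv_div]

/-! ### From the moment recursion to a density -/

/-- A law on `(0, ∞)` that satisfies the moment recursion has the density `x ^ (-m) * I^α μ`: the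
measures `x ^ m μ(dx)` and `I^α μ(x) dx` have the same moments. -/
lemma MomentRecursion.eq_withDensity {α m : ℝ} (hα : 0 < α) (hm : α < m) {μ : Measure ℝ}
    [IsProbabilityMeasure μ] (hμ : ∀ᵐ x ∂μ, 0 < x) (h : MomentRecursion α (m - α) μ) :
    μ = (volume.restrict (Ioi 0)).withDensity
      fun x => ENNReal.ofReal (x ^ (-m)) * fracIntegral α μ x := by
  have ha : 0 < m - α := sub_pos.2 hm
  have hg := measurable_fracIntegral α μ
  -- both measures carry the extra weight `x ^ (-(1 + α))`, which makes them finite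
  set ν₁ := μ.withDensity fun x => ENNReal.ofReal (x ^ (m - (1 + α))) with hν₁
  set ν₂ := (volume.restrict (Ioi (0 : ℝ))).withDensity
    fun x => ENNReal.ofReal (x ^ (-(1 + α))) * fracIntegral α μ x with hν₂
  have hpos₁ : ∀ᵐ x ∂ν₁, 0 < x := (withDensity_absolutelyContinuous _ _).ae_le hμ
  have hpos₂ : ∀ᵐ x ∂ν₂, 0 < x :=
    (withDensity_absolutelyContinuous _ _).ae_le (ae_restrict_mem measurableSet_Ioi)
  have hmom₁ : ∀ s, rpowMoment ν₁ s = rpowMoment μ (m - α - (1 - s)) := by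
    intro s
    rw [rpowMoment, hν₁, lintegral_withDensity_eq_lintegral_mul _ (by fun_prop) (by fun_prop),
      rpowMoment]
    refine lintegral_congr_ae ?_
    filter_upwards [hμ] with x hx
    rw [Pi.mul_apply, ← ENNReal.ofReal_mul (by positivity), ← Real.rpow_add hx]
    ring_nf
  have hmom₂ : ∀ s, s < 1 → rpowMoment ν₂ s = rpowMoment μ (m - α - (1 - s)) := by
    intro s hs
    rw [h (1 - s) (by linarith), ← lintegral_rpow_mul_fracIntegral hα (by linarith) hμ,
      rpowMoment, hν₂, lintegral_withDensity_eq_lintegral_mul _ (by fun_prop) (by fun_prop)]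
    refine setLIntegral_congr_fun measurableSet_Ioi fun x hx => ?_
    have hx : (0 : ℝ) < x := hx
    simp only [Pi.mul_apply]
    rw [mul_right_comm, ← ENNReal.ofReal_mul (by positivity), ← Real.rpow_add hx]
    ring_nf
  have hfin : ∀ s, s < 1 → rpowMoment μ (m - α - (1 - s)) ≠ ⊤ :=
    fun s hs => h.ne_top hα ha hμ (by linarith)
  have hfm : ∀ {ρ : Measure ℝ}, rpowMoment ρ 0 ≠ ⊤ → IsFiniteMeasure ρ := by
    intro ρ hρ
    refine ⟨?_⟩
    simpa [rpowMoment, lt_top_iff_ne_top] using hρ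
  have : IsFiniteMeasure ν₁ := hfm (by rw [hmom₁]; exact hfin 0 one_pos)
  have : IsFiniteMeasure ν₂ := hfm (by rw [hmom₂ 0 one_pos]; exact hfin 0 one_pos)
  have heq : ν₁ = ν₂ := ext_of_rpowMoment_eq hpos₁ hpos₂ one_pos
    (fun s hs => by rw [hmom₁]; exact hfin s hs.2) (fun s hs => by rw [hmom₁, hmom₂ s hs.2])
  have h1 : ν₁.withDensity (fun x => ENNReal.ofReal (x ^ (-(m - (1 + α))))) = μ := by
    rw [hν₁, ← withDensity_mul _ (by fun_prop) (by fun_prop)]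
    conv_rhs => rw [← withDensity_one (μ := μ)]
    refine withDensity_congr_ae ?_
    filter_upwards [hμ] with x hx
    rw [Pi.mul_apply, ← ENNReal.ofReal_mul (by positivity), ← Real.rpow_add hx]
    simp
  have h2 : ν₂.withDensity (fun x => ENNReal.ofReal (x ^ (-(m - (1 + α))))) =
      (volume.restrict (Ioi 0)).withDensity
        fun x => ENNReal.ofReal (x ^ (-m)) * fracIntegral α μ x := by
    rw [hν₂, ← withDensity_mul _ (by fun_prop) (by fun_prop)]
    refine withDensity_congr_ae ?_
    filter_upwards [ae_restrict_mem measurableSet_Ioi] with x hx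
    have hx : (0 : ℝ) < x := hx
    rw [Pi.mul_apply, mul_right_comm, ← ENNReal.ofReal_mul (by positivity), ← Real.rpow_add hx]
    ring_nf
  rw [← h2, ← heq, h1]

/-- The Beta integral over an interval `(y, x)`. -/
lemma lintegral_Ioo_rpow_mul_rpow {p q x y : ℝ} (hp : 0 < p) (hq : 0 < q) (hxy : y < x) :
    ∫⁻ w in Ioo y x, ENNReal.ofReal ((x - w) ^ (p - 1) * (w - y) ^ (q - 1)) =
      ENNReal.ofReal (beta q p) * ENNReal.ofReal ((x - y) ^ (p + q - 1)) := by
  have hB := beta_pos hq hp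
  have hd : 0 < x - y := sub_pos.2 hxy
  have himg : (fun u => y + (x - y) * u) '' Ioo 0 1 = Ioo y x := by
    ext w
    constructor
    · rintro ⟨u, ⟨h0, h1⟩, rfl⟩
      constructor
      · have := mul_pos hd h0
        simp only; linarith
      · have := mul_lt_mul_of_pos_left h1 hd
        simp only; linarith
    · rintro ⟨h0, h1⟩
      refine ⟨(w - y) / (x - y), ⟨div_pos (sub_pos.2 h0) hd, ?_⟩, ?_⟩
      · rw [div_lt_one hd]; linarith
      · simp only; field_simp; ring
  have hone := lintegral_betaPDF_eq_one hq hp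
  rw [lintegral_betaPDF] at hone
  rw [← himg, lintegral_image_eq_lintegral_abs_deriv_mul (f' := fun _ => x - y) measurableSet_Ioo]
  · rw [← mul_one (ENNReal.ofReal (beta q p) * ENNReal.ofReal ((x - y) ^ (p + q - 1))), ← hone,
      ← ENNReal.ofReal_mul hB.le, ← lintegral_const_mul' _ _ ENNReal.ofReal_ne_top]
    refine setLIntegral_congr_fun measurableSet_Ioo fun u hu => ?_
    have h0 := hu.1
    have h1 : 0 < 1 - u := sub_pos.2 hu.2
    rw [abs_of_pos hd, ← ENNReal.ofReal_mul hd.le, ← ENNReal.ofReal_mul (by positivity),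
      show x - (y + (x - y) * u) = (x - y) * (1 - u) by ring,
      show y + (x - y) * u - y = (x - y) * u by ring, Real.mul_rpow hd.le h1.le,
      Real.mul_rpow hd.le h0.le, show p + q - 1 = 1 + (p - 1) + (q - 1) by ring,
      Real.rpow_add hd, Real.rpow_add hd, Real.rpow_one]
    congr 1
    field_simp
  · intro u _
    simpa using (((hasDerivAt_id u).const_mul (x - y)).const_add y).hasDerivWithinAt
  · intro u _ v _ h
    have : (x - y) * u = (x - y) * v := by simpa using h
    exact mul_left_cancel₀ hd.ne' this

/-- One step of the bootstrap: the integral of the fractional integral `I^α μ` against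
`(x - w) ^ (β - 1) w ^ (-r)` is bounded by an integral against a kernel that is smoother
by `α`. -/
lemma lintegral_mul_fracIntegral_le {α β r x : ℝ} (hα : 0 < α) (hβ : 0 < β) (hr : 0 ≤ r)
    {μ : Measure ℝ} [SFinite μ] (hμ : ∀ᵐ x ∂μ, 0 < x) :
    ∫⁻ w in Ioo 0 x, ENNReal.ofReal ((x - w) ^ (β - 1) * w ^ (-r)) * fracIntegral α μ w ≤
      ENNReal.ofReal (1 / Real.Gamma α) * ENNReal.ofReal (beta α β) *
        ∫⁻ y in Ioo 0 x, ENNReal.ofReal ((x - y) ^ (β + α - 1) * y ^ (-r)) ∂μ := by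
  have hk := measurable_fracIntegral_kernel α
  simp_rw [fracIntegral_eq_lintegral_indicator]
  set K := {z : ℝ × ℝ | z.2 ∈ Ioo 0 z.1}.indicator
      (fun z => ENNReal.ofReal ((z.1 - z.2) ^ (α - 1))) with hK
  calc _ = ENNReal.ofReal (1 / Real.Gamma α) * ∫⁻ w in Ioo 0 x, ∫⁻ y,
        ENNReal.ofReal ((x - w) ^ (β - 1) * w ^ (-r)) * K (w, y) ∂μ := by
        rw [← lintegral_const_mul' _ _ ENNReal.ofReal_ne_top]
        refine lintegral_congr fun w => ?_
        rw [lintegral_const_mul' _ _ ENNReal.ofReal_ne_top]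
        ring
    _ = ENNReal.ofReal (1 / Real.Gamma α) * ∫⁻ y, (∫⁻ w in Ioo 0 x,
        ENNReal.ofReal ((x - w) ^ (β - 1) * w ^ (-r)) * K (w, y)) ∂μ := by
        rw [lintegral_lintegral_swap (by fun_prop)]
    _ ≤ ENNReal.ofReal (1 / Real.Gamma α) * ∫⁻ y, (Ioo 0 x).indicator (fun y =>
        ENNReal.ofReal (beta α β) * ENNReal.ofReal ((x - y) ^ (β + α - 1) * y ^ (-r))) y ∂μ := by
        refine mul_le_mul' le_rfl (lintegral_mono_ae ?_)
        filter_upwards [hμ] with y hy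
        by_cases hyx : y < x
        · rw [indicator_of_mem (show y ∈ Ioo 0 x from ⟨hy, hyx⟩), mul_comm ((x - y) ^ _),
            ENNReal.ofReal_mul (by positivity), mul_left_comm,
            ← lintegral_Ioo_rpow_mul_rpow hβ hα hyx,
            ← lintegral_const_mul' _ _ ENNReal.ofReal_ne_top,
            ← lintegral_indicator measurableSet_Ioo, ← lintegral_indicator measurableSet_Ioo]
          refine lintegral_mono fun w => ?_
          by_cases hw : w ∈ Ioo y x
          · have hwx : 0 < x - w := sub_pos.2 hw.2
            have hyw : 0 < w - y := sub_pos.2 hw.1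
            have hw0 : 0 < w := hy.trans hw.1
            rw [indicator_of_mem hw, indicator_of_mem (show w ∈ Ioo 0 x from ⟨hw0, hw.2⟩), hK,
              indicator_of_mem (show (w, y) ∈ {z : ℝ × ℝ | z.2 ∈ Ioo 0 z.1} from ⟨hy, hw.1⟩),
              ← ENNReal.ofReal_mul (by positivity), ← ENNReal.ofReal_mul (by positivity)]
            refine ENNReal.ofReal_le_ofReal ?_
            have := Real.rpow_le_rpow_of_nonpos hy hw.1.le (neg_nonpos.2 hr)
            calc (x - w) ^ (β - 1) * w ^ (-r) * (w - y) ^ (α - 1) =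
                w ^ (-r) * ((x - w) ^ (β - 1) * (w - y) ^ (α - 1)) := by ring
              _ ≤ _ := mul_le_mul_of_nonneg_right this (by positivity)
          · rw [indicator_of_notMem hw]
            by_cases hw' : w ∈ Ioo 0 x
            · have : (w, y) ∉ {z : ℝ × ℝ | z.2 ∈ Ioo 0 z.1} := fun h => hw ⟨h.2, hw'.2⟩
              rw [indicator_of_mem hw', hK, indicator_of_notMem this, mul_zero]
            · rw [indicator_of_notMem hw']
        · rw [indicator_of_notMem fun h => hyx h.2, nonpos_iff_eq_zero]
          refine (setLIntegral_congr_fun (g := fun _ => 0) measurableSet_Ioo fun w hw => ?_).trans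
            (by simp)
          have : (w, y) ∉ {z : ℝ × ℝ | z.2 ∈ Ioo 0 z.1} := fun h => hyx (h.2.trans hw.2)
          simp only
          rw [hK, indicator_of_notMem this, mul_zero]
    _ = _ := by
        rw [lintegral_indicator measurableSet_Ioo, lintegral_const_mul' _ _ ENNReal.ofReal_ne_top,
          mul_assoc]

/-- Under the moment recursion the fractional integral of the law is finite everywhere, not only
almost everywhere: iterating the equation replaces the kernel `(x - v) ^ (α - 1)` by a bounded
one, and all negative moments are finite. -/
lemma MomentRecursion.fracIntegral_ne_top {α m : ℝ} (hα : 0 < α) (hm : α < m) {μ : Measure ℝ}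
    [IsProbabilityMeasure μ] (hμ : ∀ᵐ x ∂μ, 0 < x) (h : MomentRecursion α (m - α) μ) (x : ℝ) :
    fracIntegral α μ x ≠ ⊤ := by
  have hg := measurable_fracIntegral α μ
  have hm0 : 0 < m := hα.trans hm
  have key : ∀ k : ℕ, ∃ C : ENNReal, C ≠ ⊤ ∧ fracIntegral α μ x ≤
      C * ∫⁻ w in Ioo 0 x, ENNReal.ofReal ((x - w) ^ ((k + 1) * α - 1) * w ^ (-(k * m))) ∂μ := by
    intro k
    induction k with
    | zero =>
      refine ⟨ENNReal.ofReal (1 / Real.Gamma α), ENNReal.ofReal_ne_top, le_of_eq ?_⟩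
      simp [fracIntegral]
    | succ k ih =>
      obtain ⟨C, hC, hle⟩ := ih
      have hβ : 0 < ((k : ℝ) + 1) * α := by positivity
      have e : ∫⁻ w in Ioo 0 x,
          ENNReal.ofReal ((x - w) ^ (((k : ℝ) + 1) * α - 1) * w ^ (-(k * m))) ∂μ =
          ∫⁻ w in Ioo 0 x, ENNReal.ofReal ((x - w) ^ (((k : ℝ) + 1) * α - 1) *
            w ^ (-((k + 1 : ℝ) * m))) * fracIntegral α μ w := by
        conv_lhs => rw [h.eq_withDensity hα hm hμ]
        rw [restrict_withDensity measurableSet_Ioo, Measure.restrict_restrict measurableSet_Ioo,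
          inter_eq_left.2 (show Ioo 0 x ⊆ Ioi 0 from fun v hv => hv.1),
          lintegral_withDensity_eq_lintegral_mul _ (by fun_prop) (by fun_prop)]
        refine setLIntegral_congr_fun measurableSet_Ioo fun w hw => ?_
        have hwx : 0 < x - w := sub_pos.2 hw.2
        have hw0 := hw.1
        simp only [Pi.mul_apply]
        rw [mul_right_comm, ← ENNReal.ofReal_mul (by positivity), mul_left_comm,
          ← Real.rpow_add hw0]
        ring_nf
      refine ⟨C * (ENNReal.ofReal (1 / Real.Gamma α) *
        ENNReal.ofReal (beta α (((k : ℝ) + 1) * α))), ENNReal.mul_ne_top hC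
          (ENNReal.mul_ne_top ENNReal.ofReal_ne_top ENNReal.ofReal_ne_top), hle.trans ?_⟩
      rw [e, mul_assoc]
      refine mul_le_mul' le_rfl ?_
      refine (lintegral_mul_fracIntegral_le hα hβ (by positivity) hμ).trans (le_of_eq ?_)
      push_cast
      rw [show ((k : ℝ) + 1) * α + α - 1 = (k + 1 + 1) * α - 1 by ring]
  obtain ⟨k, hk⟩ := exists_nat_ge (1 / α)
  have hk' : 0 ≤ ((k : ℝ) + 1) * α - 1 := by
    rw [div_le_iff₀ hα] at hk
    linarith
  obtain ⟨C, hC, hle⟩ := key k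
  refine ne_top_of_le_ne_top (ENNReal.mul_ne_top hC ?_) hle
  have hneg : rpowMoment μ (-(k * m)) ≠ ⊤ :=
    h.ne_top hα (sub_pos.2 hm) hμ (by
      have : 0 ≤ (k : ℝ) * m := by positivity
      linarith)
  refine ne_top_of_le_ne_top (ENNReal.mul_ne_top (ENNReal.ofReal_ne_top
    (r := x ^ (((k : ℝ) + 1) * α - 1))) hneg) ?_
  rw [rpowMoment, ← lintegral_const_mul' _ _ ENNReal.ofReal_ne_top]
  refine (setLIntegral_mono (by fun_prop) fun w hw => ?_).trans (setLIntegral_le_lintegral _ _)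
  have hwx : 0 < x - w := sub_pos.2 hw.2
  have hw0 := hw.1
  have hx0 : 0 < x := hw0.trans hw.2
  rw [← ENNReal.ofReal_mul (by positivity)]
  refine ENNReal.ofReal_le_ofReal (mul_le_mul_of_nonneg_right ?_ (by positivity))
  exact Real.rpow_le_rpow hwx.le (by linarith) hk'

/-- A law on `(0, ∞)` that satisfies the moment recursion has a density that solves the equation at
every `x > 0`. -/
lemma MomentRecursion.exists_isDensitySolution {α m : ℝ} (hα : 0 < α) (hm : α < m)
    {μ : Measure ℝ} [IsProbabilityMeasure μ] (hμ : ∀ᵐ x ∂μ, 0 < x)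
    (h : MomentRecursion α (m - α) μ) : ∃ f, IsDensitySolution α m f := by
  have hg := measurable_fracIntegral α μ
  set f : ℝ → ℝ := fun x => x ^ (-m) * (fracIntegral α μ x).toReal with hf
  have hof : ∀ x, 0 < x →
      ENNReal.ofReal (f x) = ENNReal.ofReal (x ^ (-m)) * fracIntegral α μ x := by
    intro x hx
    rw [hf, ENNReal.ofReal_mul (by positivity),
      ENNReal.ofReal_toReal (h.fracIntegral_ne_top hα hm hμ x)]
  have hlaw : densityLaw f = μ := by
    conv_rhs => rw [h.eq_withDensity hα hm hμ]
    refine withDensity_congr_ae ?_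
    filter_upwards [ae_restrict_mem measurableSet_Ioi] with x hx using hof x hx
  have hdens : IsPositiveDensity f := by
    refine ⟨by fun_prop, ?_, ?_⟩
    · filter_upwards [ae_restrict_mem measurableSet_Ioi] with x hx
      have hx : (0 : ℝ) < x := hx
      positivity
    · have h1 : densityLaw f univ = 1 := by rw [hlaw]; exact measure_univ
      rwa [densityLaw, withDensity_apply _ MeasurableSet.univ, Measure.restrict_univ] at h1
  refine ⟨f, hdens, fun x hx => ?_⟩
  rw [hdens.solvesAt_iff hα, hlaw]
  refine ⟨h.fracIntegral_ne_top hα hm hμ x, ?_⟩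
  rw [hf, ← mul_assoc, ← Real.rpow_add hx]
  simp

lemma MomentRecursion.hasLaw {α a : ℝ} (hα : 0 < α) (ha : 0 < a) {μ : Measure ℝ}
    [IsProbabilityMeasure μ] (hμ : ∀ᵐ x ∂μ, 0 < x) (h : MomentRecursion α a μ)
    {Ω : Type*} [MeasurableSpace Ω] {P : Measure Ω} [IsProbabilityMeasure P] {X : Ω → ℝ}
    (hX : AEMeasurable X P) (hpos : ∀ᵐ ω ∂P, 0 < X ω) (h' : MomentRecursion α a (P.map X)) :
    HasLaw X μ P := by
  have := Measure.isProbabilityMeasure_map hX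
  exact ⟨hX, h'.unique hα ha ((ae_map_iff hX measurableSet_Ioi).2 hpos) hμ h⟩

/-! ### Existence, uniqueness and the product representations -/

lemma IsAEDensitySolution.lt {α m : ℝ} (hα : 0 < α) {f : ℝ → ℝ}
    (hf : IsAEDensitySolution α m f) : α < m := by
  have := hf.density.isProbabilityMeasure
  exact lt_of_laplace_eq hα (densityLaw_pos f) fun l hl => hf.laplace_eq hα hl

lemma exists_isDensitySolution {α m : ℝ} (hα : 0 < α) (hm : α < m) :
    ∃ f, IsDensitySolution α m f := by
  have ha : 0 < m - α := sub_pos.2 hm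
  have hprob : ∀ n : ℕ, IsProbabilityMeasure
      (betaMeasure ((m - α) + (m - α) * n) (m - (m - α))) := fun n =>
    isProbabilityMeasureBeta (by positivity) (by simpa using hα)
  obtain ⟨Ω, _, P, B, -, hlaw, hind, hP⟩ := exists_hasLaw_indepFun (fun _ : ℕ => ℝ)
    fun n => betaMeasure ((m - α) + (m - α) * n) (m - (m - α))
  have hB : IsIndepBetaSeq (fun n => (m - α) + (m - α) * n) (fun _ => m - (m - α)) B P :=
    ⟨hlaw, hind⟩
  obtain ⟨Z, hZm, hZ, hrec⟩ := hB.exists_momentRecursion_inv hα ha (by ring)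
  have hXm : AEMeasurable (fun ω => ((m - α) ^ ((m - (m - α)) / (m - α)) *
      Real.Gamma (m / (m - α)) * Z ω) ^ (-1 : ℝ)) P := by fun_prop
  have := Measure.isProbabilityMeasure_map hXm
  refine hrec.exists_isDensitySolution hα hm ((ae_map_iff hXm measurableSet_Ioi).2 ?_)
  filter_upwards [hZ] with ω h
  have := Real.Gamma_pos_of_pos (show 0 < m / (m - α) from div_pos (hα.trans hm) ha)
  have := h.1
  positivity

lemma IsAEDensitySolution.densityLaw_eq {α m : ℝ} (hα : 0 < α) {f g : ℝ → ℝ}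
    (hf : IsAEDensitySolution α m f) (hg : IsAEDensitySolution α m g) :
    densityLaw f = densityLaw g := by
  have := hf.density.isProbabilityMeasure
  have := hg.density.isProbabilityMeasure
  exact (hf.momentRecursion hα).unique hα (sub_pos.2 (hf.lt hα)) (densityLaw_pos f)
    (densityLaw_pos g) (hg.momentRecursion hα)

theorem mainTheorem1 (α m : ℝ) (hα : 0 < α) :
    -- existence
    ((∃ f, IsDensitySolution α m f) ↔ α < m) ∧
    ((∃ f, IsAEDensitySolution α m f) ↔ α < m) ∧
    -- uniqueness
    (∀ f g, IsDensitySolution α m f → IsDensitySolution α m g → EqOn f g (Ioi 0)) ∧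
    (∀ f g, IsAEDensitySolution α m f → IsAEDensitySolution α m g →
      f =ᵐ[volume.restrict (Ioi 0)] g) ∧
    -- the two product representations of the law with density `f`
    (∀ f, IsAEDensitySolution α m f → ∀ a, a = m - α →
      ∀ (Ω : Type u) [MeasurableSpace Ω] (P : Measure Ω) [IsProbabilityMeasure P]
        (B : ℕ → Ω → ℝ),
        (IsIndepBetaSeq (fun n => a + a * n) (fun _ => m - a) B P →
          ∃ Z : Ω → ℝ,
            IsASInfiniteProduct (fun n ω => (m + a * n) / (a + a * n) * B n ω) Z P ∧
            HasLaw (fun ω => (a ^ ((m - a) / a) * Real.Gamma (m / a) * Z ω)⁻¹)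
              (densityLaw f) P) ∧
        (IsIndepBetaSeq (fun n => 1 + n / a) (fun _ => m / a - 1) B P →
          ∃ Z : Ω → ℝ,
            IsASInfiniteProduct (fun n ω => (m + n) / (a + n) * B n ω) Z P ∧
            HasLaw (fun ω => (Real.Gamma m / Real.Gamma a * Z ω) ^ (-(1 / a)))
              (densityLaw f) P)) := by
  refine ⟨⟨fun ⟨f, hf⟩ => hf.isAEDensitySolution.lt hα, exists_isDensitySolution hα⟩,
    ⟨fun ⟨f, hf⟩ => hf.lt hα, fun h => ?_⟩, fun f g hf hg x hx => ?_, fun f g hf hg => ?_, ?_⟩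
  · obtain ⟨f, hf⟩ := exists_isDensitySolution hα h
    exact ⟨f, hf.isAEDensitySolution⟩
  · have hx : (0 : ℝ) < x := hx
    have h1 := ((hf.density.solvesAt_iff hα).1 (hf.solves x hx)).2
    have h2 := ((hg.density.solvesAt_iff hα).1 (hg.solves x hx)).2
    rw [hf.isAEDensitySolution.densityLaw_eq hα hg.isAEDensitySolution, ← h2] at h1
    exact mul_left_cancel₀ (Real.rpow_pos_of_pos hx m).ne' h1
  · have h := hf.densityLaw_eq hα hg
    rw [densityLaw, densityLaw, withDensity_eq_iff_of_sigmaFinite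
      hf.density.aemeasurable.ennreal_ofReal hg.density.aemeasurable.ennreal_ofReal] at h
    filter_upwards [h, hf.density.nonneg, hg.density.nonneg] with x h1 h2 h3
    exact (ENNReal.ofReal_eq_ofReal_iff h2 h3).1 h1
  · rintro f hf a rfl Ω _ P _ B
    have := hf.density.isProbabilityMeasure
    have hm := hf.lt hα
    have ha : 0 < m - α := sub_pos.2 hm
    have hrec := hf.momentRecursion hα
    constructor
    · intro hB
      obtain ⟨Z, hZm, hZ, hZrec⟩ := hB.exists_momentRecursion_inv hα ha (by ring)
      refine ⟨Z, hZ, ?_⟩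
      simp_rw [← Real.rpow_neg_one]
      refine hrec.hasLaw hα ha (densityLaw_pos f) (by fun_prop) ?_ hZrec
      filter_upwards [hZ] with ω h
      have := Real.Gamma_pos_of_pos (show 0 < m / (m - α) from div_pos (hα.trans hm) ha)
      have := h.1
      positivity
    · intro hB
      obtain ⟨Z, hZm, hZ, hZrec⟩ := hB.exists_momentRecursion_rpow hα ha (by ring)
      refine ⟨Z, hZ, hrec.hasLaw hα ha (densityLaw_pos f) (by fun_prop) ?_ hZrec⟩
      filter_upwards [hZ] with ω h
      have := Real.Gamma_pos_of_pos (hα.trans hm)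
      have := Real.Gamma_pos_of_pos ha
      have := h.1
      positivity
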